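/- Let $\mathbb{F}_q$ be a finite field with $q$ elements, $A=\mathbb{F}_q[\theta]$, $k=\mathbb{F}_q(\theta)$, $k_\infty=\mathbb{F}_q((1/\theta))$ the completion of $k$ at the infinite place, $\mathbb{C}_\infty$ the completion of an algebraic closure of $k_\infty$, with $|\theta|=q$, and $\bar k$ the algebraic closure of $k$ in $\mathbb{C}_\infty$. For $f=\sum_i a_it^i$ over $\mathbb{C}_\infty$ and $n\in\mathbb{Z}$ put $f^{(n)}=\sum_i a_i^{q^n}t^i$. Let $\mathbb{T}\subset\mathbb{C}_\infty[[t]]$ be the Tate algebra (power series converging for $|t|\le 1$) and $\mathbb{L}$ its fraction field; the twist extends to $\bar k(t)$ and to $\mathbb{L}$. A pre-$t$-motive is a left module $M$ over the ring $\bar k(t)[\sigma,\sigma^{-1}]$ (with $\sigma f=f^{(-1)}\sigma$) that is finite dimensional over $\bar k(t)$. If $\Phi$ represents $\sigma$ in a basis $\mathbf m$ of $M$ ($\sigma\mathbf m=\Phi\mathbf m$), a rigid analytic trivialization of $\Phi$ is a matrix $\Psi\in\mathrm{GL}_n(\mathbb{L})$ with $\Psi^{(-1)}=\Phi\Psi$;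 if all entries of $\Psi$ are power series in $\mathbb{T}$ that converge at $t=\theta$, the entries of $\Psi|_{t=\theta}$ are called periods of $M$. Fix $\lambda\in\mathbb{C}_\infty$ with $\lambda^{q-1}=-\theta$ and put $$\Omega=\lambda^{-q}\prod_{i\ge 1}\bigl(1-t/\theta^{q^i}\bigr),\qquad \tilde\pi=\frac1{\Omega(\theta)} .$$ Let $D_i=\prod_{j<i}(\theta^{q^i}-\theta^{q^j})$, let $\Gamma_{n+1}=\prod_i D_i^{n_i}$ for $n=\sum_i n_iq^i$ with $0\le n_i\le q-1$, and let $S_d(s)=\sum 1/a^s$, summed over the monic $a\in A$ of degree $d$. Let $r\ge 0$, let $\mathfrak{s}=(s_1,\dots,s_r)$ be positive integers with $w=s_1+\cdots+s_r$, let $\boldsymbol\epsilon\in(\mathbb{F}_q^\times)^r$, and let $\gamma_i\in\bar k$ satisfy $\gamma_i^{q-1}=\epsilon_i$. Put $$\zeta_A(\mathfrak{s};\boldsymbol\epsilon)=\sum\frac{\epsilon_1^{\deg a_1}\cdots\epsilon_r^{\deg a_r}}{a_1^{s_1}\cdots a_r^{s_r}}\in k_\infty ,$$ the sum being over all monic $a_1,\dots,a_r\in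 A$ with $\deg a_1>\cdots>\deg a_r\ge 0$. Then: 1. The product $\Omega$ converges coefficientwise, $\Omega$ converges at $t=\theta$, and $\Omega(\theta)\ne 0$. 2. For every $s\ge 1$ there is a unique polynomial $H_{s-1}\in A[t]$ (the Anderson–Thakur polynomial) such that $(H_{s-1}\Omega^s)^{(d)}|_{t=\theta}=\Gamma_sS_d(s)/\tilde\pi^s$ for all $d\ge 0$. 3. The series $\zeta_A(\mathfrak{s};\boldsymbol\epsilon)$ converges and, for all $1\le j\le i\le r+1$, so does coefficientwise the series $$L(s_j,\dots,s_{i-1})=\sum_{d_j>\cdots>d_{i-1}\ge 0}\ \prod_{n=j}^{i-1}\epsilon_n^{d_n}\,(H_{s_n-1}\Omega^{s_n})^{(d_n)}$$ (equal to $1$ for $i=j$). 4. Let $\Phi$ be the $(r+1)\times(r+1)$ matrix over $\bar k(t)$ with $\Phi_{ii}=(t-\theta)^{s_i+\cdots+s_r}$ for $1\le i\le r+1$ (so that $\Phi_{r+1,r+1}=1$), with $\Phi_{i+1,i}=\gamma_i^{(-1)}(t-\theta)^{s_i+\cdots+s_r}H_{s_i-1}^{(-1)}$ for $1\le i\le r$,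 and with all other entries zero. The $\bar k(t)$-vector space $M$ with basis $\mathbf m=(m_1,\dots,m_{r+1})$ on which $\sigma$ acts by $\sigma\mathbf m=\Phi\mathbf m$ is a pre-$t$-motive of dimension $r+1$. 5. Let $\Psi$ be the lower triangular $(r+1)\times(r+1)$ matrix with entries $$\Psi_{ij}=\gamma_j\cdots\gamma_{i-1}\,L(s_j,\dots,s_{i-1})\,\Omega^{s_i+\cdots+s_r}\qquad(j\le i).$$ Its entries belong to $\mathbb{T}$ and converge at $t=\theta$, $\Psi\in\mathrm{GL}_{r+1}(\mathbb{L})$, and $\Psi^{(-1)}=\Phi\Psi$; that is, $\Psi$ is a rigid analytic trivialization of $\Phi$. 6. The lower left entry of $\Psi|_{t=\theta}$ is $$\Psi_{r+1,1}(\theta)=\gamma_1\cdots\gamma_r\,\frac{\Gamma_{s_1}\cdots\Gamma_{s_r}}{\tilde\pi^{w}}\,\zeta_A(\mathfrak{s};\boldsymbol\epsilon),$$ and hence this multiple of $\zeta_A(\mathfrak{s};\boldsymbol\epsilon)$ is a period of $M$. -/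

import Mathlib

noncomputable section

namespace AMZV

open Filter Topology
open scoped NNReal Polynomial

section Fields

variable (Fq : Type*) [Field Fq] [Fintype Fq]

/-- `k_∞ = F_q((1/θ))`: the completion of `k = F_q(θ)` at the infinite place. -/
abbrev KInf : Type _ :=
  @RatFunc.CompletionAtInfty Fq _ (Classical.decEq _)

theorem one_lt_card_nnreal : (1 : ℝ≥0) < (Fintype.card Fq : ℝ≥0) := by
  exact_mod_cast Fintype.one_lt_card

theorem valued_algebraMap (x : RatFunc Fq) :
    (Valued.v (algebraMap (RatFunc Fq) (KInf Fq) x) : WithZero (Multiplicative ℤ)) =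
      @RatFunc.inftyValuationDef Fq _ (Classical.decEq _) x := by
  let _ := Classical.decEq (RatFunc Fq)
  let _ := RatFunc.inftyValued Fq
  exact Valued.extensionValuation_apply_coe x

theorem valued_theta :
    (Valued.v (algebraMap (RatFunc Fq) (KInf Fq) RatFunc.X) : WithZero (Multiplicative ℤ)) =
      WithZero.exp 1 := by
  rw [valued_algebraMap]
  simp [RatFunc.inftyValuationDef, RatFunc.X_ne_zero]

/-- The real-valued absolute value on `k_∞` is normalised by `|θ| = q`. -/
instance rankOneKInf :
    Valuation.RankOne (Valued.v : Valuation (KInf Fq) (WithZero (Multiplicative ℤ))) where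
  hom' := (WithZeroMulInt.toNNReal (one_lt_card_nnreal Fq).ne_zero).comp
    MonoidWithZeroHom.ValueGroup₀.embedding
  strictMono' := (WithZeroMulInt.toNNReal_strictMono (one_lt_card_nnreal Fq)).comp
    MonoidWithZeroHom.ValueGroup₀.embedding_strictMono
  exists_val_nontrivial := by
    refine ⟨algebraMap (RatFunc Fq) (KInf Fq) RatFunc.X, ?_, ?_⟩ <;> rw [valued_theta] <;> simp

instance : NontriviallyNormedField (KInf Fq) :=
  Valued.toNontriviallyNormedField _ (WithZero (Multiplicative ℤ))

instance : IsUltrametricDist (KInf Fq) := Valued.instIsUltrametricDist _ _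

instance : CompleteSpace (KInf Fq) := by
  let _ := Classical.decEq (RatFunc Fq)
  let _ := (RatFunc.inftyValued Fq).toUniformSpace
  exact inferInstanceAs (CompleteSpace (UniformSpace.Completion (RatFunc Fq)))

/-- An algebraic closure of `k_∞`, with the unique absolute value extending that of `k_∞`. -/
abbrev KInfBar : Type _ := AlgebraicClosure (KInf Fq)

instance : NormedField (KInfBar Fq) := spectralNorm.normedField (KInf Fq) (KInfBar Fq)

instance : NormedAlgebra (KInf Fq) (KInfBar Fq) := spectralNorm.normedAlgebra _ _

instance : IsUltrametricDist (KInfBar Fq) :=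
  IsUltrametricDist.isUltrametricDist_of_forall_norm_add_le_max_norm
    (isNonarchimedean_spectralNorm (K := KInf Fq) (L := KInfBar Fq))

instance : UniformContinuousConstSMul (KInf Fq) (KInfBar Fq) :=
  uniformContinuousConstSMul_of_continuousConstSMul _ _

/-- `ℂ_∞`: the completion of the algebraic closure of `k_∞`. -/
abbrev CInf : Type _ := UniformSpace.Completion (KInfBar Fq)

instance : IsScalarTower (KInf Fq) (KInfBar Fq) (CInf Fq) :=
  IsScalarTower.of_algebraMap_eq (congrFun rfl)

instance : IsUltrametricDist (CInf Fq) := IsUltrametricDist.of_normedAlgebra (KInf Fq)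

/-- `ℂ_∞` as an extension of `k = F_q(θ)`. -/
instance : Algebra (RatFunc Fq) (CInf Fq) :=
  ((algebraMap (KInf Fq) (CInf Fq)).comp (algebraMap (RatFunc Fq) (KInf Fq))).toAlgebra

instance : Algebra Fq (CInf Fq) :=
  ((algebraMap (RatFunc Fq) (CInf Fq)).comp (algebraMap Fq (RatFunc Fq))).toAlgebra

/-- `k̄`: the algebraic closure of `k` in `ℂ_∞`. -/
abbrev KBar : Type _ := algebraicClosure (RatFunc Fq) (CInf Fq)

/-- `θ` as an element of `ℂ_∞`. -/
def theta : CInf Fq := algebraMap (RatFunc Fq) (CInf Fq) RatFunc.X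

/-- `θ` as an element of `k̄`. -/
def thetaBar : KBar Fq := algebraMap (RatFunc Fq) (KBar Fq) RatFunc.X

theorem norm_theta : ‖theta Fq‖ = Fintype.card Fq := by
  have h1 : ‖algebraMap (RatFunc Fq) (KInf Fq) RatFunc.X‖ = Fintype.card Fq := by
    have h : (‖algebraMap (RatFunc Fq) (KInf Fq) RatFunc.X‖ : ℝ) =
        (WithZeroMulInt.toNNReal (one_lt_card_nnreal Fq).ne_zero
          (MonoidWithZeroHom.ValueGroup₀.embedding
            (Valued.v.restrict (algebraMap (RatFunc Fq) (KInf Fq) RatFunc.X)))) := rfl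
    rw [h, Valuation.embedding_restrict, valued_theta,
      WithZeroMulInt.toNNReal_neg_apply _ WithZero.exp_ne_zero]
    have h3 : Multiplicative.toAdd (WithZero.unzero (WithZero.exp_ne_zero (a := (1 : ℤ)))) = 1 :=
      rfl
    rw [h3]
    simp
  have h2 : theta Fq = algebraMap (KInf Fq) (CInf Fq)
    (algebraMap (RatFunc Fq) (KInf Fq) RatFunc.X) := rfl
  rw [h2, norm_algebraMap', h1]

end Fields

section Frobenius

variable (Fq : Type*) [Field Fq] [Fintype Fq]

theorem frob_sub (x y : CInf Fq) :
    x ^ Fintype.card Fq - y ^ Fintype.card Fq = (x - y) ^ Fintype.card Fq :=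
  (map_sub (FiniteField.frobeniusAlgHom Fq (CInf Fq)) x y).symm

theorem surjective_pow_card :
    Function.Surjective (fun x : CInf Fq => x ^ Fintype.card Fq) := by
  have hq : Fintype.card Fq ≠ 0 := Fintype.card_ne_zero
  intro z
  have hcl : z ∈ closure (Set.range ((↑) : KInfBar Fq → CInf Fq)) :=
    UniformSpace.Completion.denseRange_coe z
  obtain ⟨u, hu, hlim⟩ := mem_closure_iff_seq_limit.mp hcl
  have hroot : ∀ n, ∃ x : CInf Fq, x ^ Fintype.card Fq = u n := by
    intro n
    obtain ⟨w, hw⟩ := hu n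
    obtain ⟨v, hv⟩ := IsAlgClosed.exists_pow_nat_eq w (Nat.pos_of_ne_zero hq)
    refine ⟨(v : CInf Fq), ?_⟩
    rw [← hw, ← hv]
    exact (map_pow (algebraMap (KInfBar Fq) (CInf Fq)) v _).symm
  choose x hx using hroot
  have hc : CauchySeq x := by
    rw [Metric.cauchySeq_iff]
    intro ε hε
    obtain ⟨N, hN⟩ := Metric.cauchySeq_iff.mp hlim.cauchySeq (ε ^ Fintype.card Fq) (by positivity)
    refine ⟨N, fun m hm n hn => ?_⟩
    have := hN m hm n hn
    rw [dist_eq_norm, ← hx, ← hx, frob_sub, norm_pow] at this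
    rw [dist_eq_norm]
    exact lt_of_pow_lt_pow_left₀ _ hε.le this
  obtain ⟨y, hy⟩ := cauchySeq_tendsto_of_complete hc
  refine ⟨y, tendsto_nhds_unique ((hy.pow (Fintype.card Fq)).congr hx) hlim⟩

/-- The automorphism `x ↦ x ^ q` of `ℂ_∞`. -/
def frob : RingAut (CInf Fq) :=
  RingEquiv.ofBijective (FiniteField.frobeniusAlgHom Fq (CInf Fq) : CInf Fq →+* CInf Fq)
    ⟨RingHom.injective _, surjective_pow_card Fq⟩

theorem frob_apply (x : CInf Fq) : frob Fq x = x ^ Fintype.card Fq := rfl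

theorem frob_mem_iff (x : CInf Fq) :
    x ∈ algebraicClosure (RatFunc Fq) (CInf Fq) ↔
      frob Fq x ∈ algebraicClosure (RatFunc Fq) (CInf Fq) := by
  rw [mem_algebraicClosure_iff, mem_algebraicClosure_iff, frob_apply]
  exact ⟨fun h => h.pow _, fun h => h.of_pow Fintype.card_pos⟩

/-- The automorphism `x ↦ x ^ q` of `k̄`. -/
def frobBar : RingAut (KBar Fq) :=
  RingEquiv.restrict (frob Fq) (algebraicClosure (RatFunc Fq) (CInf Fq))
    (algebraicClosure (RatFunc Fq) (CInf Fq)) (frob_mem_iff Fq)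

theorem frobBar_apply (x : KBar Fq) : frobBar Fq x = x ^ Fintype.card Fq := rfl

variable {Fq}

/-- The `n`-fold Frobenius twist `∑ a_i t^i ↦ ∑ a_i^(q^n) t^i` of power series over `ℂ_∞`. -/
def twist (n : ℤ) : PowerSeries (CInf Fq) →+* PowerSeries (CInf Fq) :=
  PowerSeries.map ((frob Fq ^ n : RingAut (CInf Fq)) : CInf Fq →+* CInf Fq)

variable (Fq)

/-- The automorphism `f ↦ f^(1)` of `k̄(t)`, acting by `x ↦ x ^ q` on the coefficients. -/
def ratFrob : RingAut (RatFunc (KBar Fq)) :=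
  IsFractionRing.ringEquivOfRingEquiv (Polynomial.mapEquiv (frobBar Fq))

variable {Fq}

/-- The `n`-fold Frobenius twist on `k̄(t)`. -/
def ratTwist (n : ℤ) : RingAut (RatFunc (KBar Fq)) := ratFrob Fq ^ n

end Frobenius

section Tate

variable (Fq : Type*) [Field Fq] [Fintype Fq]

/-- The Tate algebra `𝕋` of power series over `ℂ_∞` converging on the closed unit disc. -/
abbrev Tate : Type _ := PowerSeries.IsRestricted.subring (R := CInf Fq) 1

variable {Fq} in
theorem mem_tate_iff {f : PowerSeries (CInf Fq)} :
    f ∈ PowerSeries.IsRestricted.subring (R := CInf Fq) 1 ↔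
      Tendsto (fun n => ‖PowerSeries.coeff n f‖) atTop (𝓝 0) := by
  refine (PowerSeries.isRestricted_iff' 1 f).trans ?_
  simp

variable {Fq} in
theorem twist_neg_one_mem {f : PowerSeries (CInf Fq)}
    (hf : f ∈ PowerSeries.IsRestricted.subring (R := CInf Fq) 1) :
    twist (-1) f ∈ PowerSeries.IsRestricted.subring (R := CInf Fq) 1 := by
  rw [mem_tate_iff] at hf ⊢
  have hq : Fintype.card Fq ≠ 0 := Fintype.card_ne_zero
  have key : ∀ n, ‖PowerSeries.coeff n (twist (-1) f)‖ ^ Fintype.card Fq =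
      ‖PowerSeries.coeff n f‖ := by
    intro n
    rw [← norm_pow, ← frob_apply]
    congr 1
    simp only [twist, PowerSeries.coeff_map, zpow_neg_one]
    exact (frob Fq).apply_symm_apply _
  rw [Metric.tendsto_atTop] at hf ⊢
  intro ε hε
  obtain ⟨N, hN⟩ := hf (ε ^ Fintype.card Fq) (by positivity)
  refine ⟨N, fun n hn => ?_⟩
  have := hN n hn
  simp only [dist_zero_right, norm_norm] at this ⊢
  rw [← key] at this
  exact lt_of_pow_lt_pow_left₀ _ hε.le this

/-- The twist `f ↦ f^(-1)` on `𝕋`. -/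
def tateTwistInv : Tate Fq →+* Tate Fq :=
  (twist (-1)).restrict _ _ fun _ hf => twist_neg_one_mem hf

theorem tateTwistInv_injective : Function.Injective (tateTwistInv Fq) := by
  intro f g h
  have h' : twist (-1) (f : PowerSeries (CInf Fq)) = twist (-1) (g : PowerSeries (CInf Fq)) :=
    congrArg Subtype.val h
  exact Subtype.ext (PowerSeries.map_injective _ (RingEquiv.injective _) h')

/-- `𝕃`: the fraction field of `𝕋`. -/
abbrev LField : Type _ := FractionRing (Tate Fq)

/-- The extension of the twist `f ↦ f^(-1)` from `𝕋` to `𝕃`. -/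
def lTwistInv : LField Fq →+* LField Fq :=
  IsFractionRing.map (tateTwistInv_injective Fq)

/-- The inclusion `k̄[t] → 𝕋`. -/
def polyToTate : (KBar Fq)[X] →+* Tate Fq :=
  RingHom.codRestrict
    ((PowerSeries.map (algebraMap (KBar Fq) (CInf Fq))).comp Polynomial.coeToPowerSeries.ringHom)
    (PowerSeries.IsRestricted.subring (R := CInf Fq) 1) (by
      intro p
      rw [mem_tate_iff]
      refine tendsto_const_nhds.congr' ?_
      filter_upwards [eventually_gt_atTop p.natDegree] with n hn
      simp [Polynomial.coeff_eq_zero_of_natDegree_lt hn])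

theorem polyToTate_injective : Function.Injective (polyToTate Fq) := by
  intro p q h
  have h' := congrArg Subtype.val h
  exact Polynomial.coe_injective _
    (PowerSeries.map_injective _ (algebraMap (KBar Fq) (CInf Fq)).injective h')

/-- The inclusion `k̄(t) → 𝕃`. -/
def ratToL : RatFunc (KBar Fq) →+* LField Fq :=
  IsFractionRing.lift (A := (KBar Fq)[X])
    (g := (algebraMap (Tate Fq) (LField Fq)).comp (polyToTate Fq))
    ((IsFractionRing.injective (Tate Fq) (LField Fq)).comp (polyToTate_injective Fq))

end Tate

section TwistedModules

variable {F : Type*} [Field F] (τ : RingAut F)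

/-- The infinite cyclic group `⟨σ⟩`, acting on the field `F` so that `σ` acts by `τ`. -/
def SigmaGroup (_τ : RingAut F) : Type := Multiplicative ℤ

instance : CommGroup (SigmaGroup τ) := inferInstanceAs (CommGroup (Multiplicative ℤ))

/-- The homomorphism `⟨σ⟩ → G` with `σ ↦ g`. -/
def sigmaHom {G : Type*} [Group G] (g : G) : SigmaGroup τ →* G := zpowersHom G g

instance : MulSemiringAction (SigmaGroup τ) F := MulSemiringAction.compHom F (sigmaHom τ τ)

/-- The generator `σ` of `⟨σ⟩`. -/
def sigmaGen : SigmaGroup τ := Multiplicative.ofAdd (1 : ℤ)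

theorem sigmaHom_sigmaGen {G : Type*} [Group G] (g : G) : sigmaHom τ g (sigmaGen τ) = g := by
  change zpowersHom G g (Multiplicative.ofAdd 1) = g
  simp

theorem sigmaGen_smul (f : F) : sigmaGen τ • f = τ f := by
  change sigmaHom τ τ (sigmaGen τ) f = τ f
  rw [sigmaHom_sigmaGen]

/-- The non-commutative Laurent polynomial ring `F[σ, σ⁻¹]` with `σ f = τ(f) σ`. -/
def TwistedLaurent : Type _ := SkewMonoidAlgebra F (SigmaGroup τ)

instance : Ring (TwistedLaurent τ) := inferInstanceAs (Ring (SkewMonoidAlgebra F (SigmaGroup τ)))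

/-- The element `σ` of `F[σ, σ⁻¹]`. -/
def sigma : TwistedLaurent τ :=
  (SkewMonoidAlgebra.single (sigmaGen τ) 1 : SkewMonoidAlgebra F (SigmaGroup τ))

/-- The inclusion `F → F[σ, σ⁻¹]`. -/
def sigmaC : F →+* TwistedLaurent τ :=
  (SkewMonoidAlgebra.singleOneRingHom : F →+* SkewMonoidAlgebra F (SigmaGroup τ))

theorem sigma_mul_sigmaC (f : F) : sigma τ * sigmaC τ f = sigmaC τ (τ f) * sigma τ := by
  have h : (SkewMonoidAlgebra.single (sigmaGen τ) 1 : SkewMonoidAlgebra F (SigmaGroup τ)) *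
      SkewMonoidAlgebra.single 1 f =
    SkewMonoidAlgebra.single 1 (τ f) * SkewMonoidAlgebra.single (sigmaGen τ) 1 := by
    simp [SkewMonoidAlgebra.single_mul_single, sigmaGen_smul]
  exact h

variable {τ} {n : ℕ}

/-- The left `F[σ, σ⁻¹]`-module attached to `Φ ∈ GL_n(F)`: the row vectors `v = ∑ v_i m_i` over `F`,
on which `σ` acts `τ`-semilinearly so that `σ m = Φ m`. -/
def ModuleOf (_τ : RingAut F) (_Φ : GL (Fin n) F) : Type _ := Fin n → F

namespace ModuleOf

variable (Φ : GL (Fin n) F)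

instance : AddCommGroup (ModuleOf τ Φ) := inferInstanceAs (AddCommGroup (Fin n → F))

instance : Module F (ModuleOf τ Φ) := inferInstanceAs (Module F (Fin n → F))

/-- The basis `m`. -/
def basis : Module.Basis (Fin n) F (ModuleOf τ Φ) := Pi.basisFun F (Fin n)

variable (τ) in
/-- The operator `v ↦ τ(v) Φ` on row vectors. -/
def rowSigma : AddMonoid.End (Fin n → F) where
  toFun v := Matrix.vecMul (fun i => τ (v i)) Φ.1
  map_zero' := by
    simp only [Pi.zero_apply, map_zero]
    exact Matrix.zero_vecMul _
  map_add' v w := by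
    simp only [Pi.add_apply, map_add]
    exact Matrix.add_vecMul _ _ _

variable (τ) in
/-- The operator `v ↦ τ⁻¹(v Φ⁻¹)` on row vectors. -/
def rowSigmaInv : AddMonoid.End (Fin n → F) where
  toFun v := fun i => τ.symm (Matrix.vecMul v (Φ⁻¹).1 i)
  map_zero' := by
    funext i
    simp
  map_add' v w := by
    funext i
    simp only [Matrix.add_vecMul, Pi.add_apply, map_add]

variable (τ) in
/-- The invertible operator `v ↦ τ(v) Φ` by which `σ` acts. -/
def rowSigmaUnit : (AddMonoid.End (Fin n → F))ˣ where
  val := rowSigma τ Φ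
  inv := rowSigmaInv τ Φ
  val_inv := by
    ext1 v
    change Matrix.vecMul (fun i => τ (τ.symm (Matrix.vecMul v (Φ⁻¹).1 i))) Φ.1 = v
    simp only [RingEquiv.apply_symm_apply]
    change Matrix.vecMul (Matrix.vecMul v (Φ⁻¹).1) Φ.1 = v
    rw [Matrix.vecMul_vecMul, ← Units.val_mul, inv_mul_cancel, Units.val_one, Matrix.vecMul_one]
  inv_val := by
    ext1 v
    change (fun i => τ.symm (Matrix.vecMul (Matrix.vecMul (fun i => τ (v i)) Φ.1) (Φ⁻¹).1 i)) = v
    funext i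
    rw [Matrix.vecMul_vecMul, ← Units.val_mul, mul_inv_cancel, Units.val_one, Matrix.vecMul_one,
      RingEquiv.symm_apply_apply]

theorem rowSigma_mul (f : F) :
    Module.toAddMonoidEnd F (Fin n → F) (τ f) * rowSigma τ Φ =
      rowSigma τ Φ * Module.toAddMonoidEnd F (Fin n → F) f := by
  ext1 v
  change τ f • Matrix.vecMul (fun i => τ (v i)) Φ.1 = Matrix.vecMul (fun i => τ (f * v i)) Φ.1
  simp only [map_mul]
  rw [← Matrix.smul_vecMul]
  rfl

theorem zpow_mul (x : SigmaGroup τ) (f : F) :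
    Module.toAddMonoidEnd F (Fin n → F) (x • f) *
        ((sigmaHom τ (rowSigmaUnit τ Φ) x : (AddMonoid.End (Fin n → F))ˣ) :
          AddMonoid.End (Fin n → F)) =
      ((sigmaHom τ (rowSigmaUnit τ Φ) x : (AddMonoid.End (Fin n → F))ˣ) :
          AddMonoid.End (Fin n → F)) * Module.toAddMonoidEnd F (Fin n → F) f := by
  let U := rowSigmaUnit τ Φ
  let T := Module.toAddMonoidEnd F (Fin n → F)
  have h1 : ∀ g : F, T (τ g) * (U : AddMonoid.End (Fin n → F)) = U * T g :=
    fun g => rowSigma_mul Φ g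
  have key : ∀ (m : ℤ) (g : F), T ((τ ^ m : RingAut F) g) *
      ((U ^ m : (AddMonoid.End (Fin n → F))ˣ) : AddMonoid.End (Fin n → F)) =
      ((U ^ m : (AddMonoid.End (Fin n → F))ˣ) : AddMonoid.End (Fin n → F)) * T g := by
    intro m
    induction m using Int.induction_on with
    | zero => intro g; simp
    | succ k ih =>
      intro g
      rw [zpow_add_one, zpow_add_one, RingAut.mul_apply, Units.val_mul, ← mul_assoc, ih, mul_assoc,
        h1, mul_assoc]
    | pred k ih =>
      intro g
      rw [zpow_sub_one, zpow_sub_one, RingAut.mul_apply, Units.val_mul, ← mul_assoc, ih, mul_assoc,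
        mul_assoc]
      congr 1
      rw [Units.mul_inv_eq_iff_eq_mul, mul_assoc, Units.eq_inv_mul_iff_mul_eq, ← h1]
      congr 2
      exact RingEquiv.apply_symm_apply τ g
  exact key x f

variable (τ) in
/-- The homomorphism from `F[σ, σ⁻¹]` to the additive endomorphisms of the row vectors by which
`F` acts by scalars and `σ` acts by `v ↦ τ(v) Φ`. -/
def actionHom : TwistedLaurent τ →+* AddMonoid.End (Fin n → F) :=
  (SkewMonoidAlgebra.liftNCRingHom (Module.toAddMonoidEnd F (Fin n → F))
    ((Units.coeHom (AddMonoid.End (Fin n → F))).comp (sigmaHom τ (rowSigmaUnit τ Φ)))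
    (fun {f x} => zpow_mul Φ x f) :
      SkewMonoidAlgebra F (SigmaGroup τ) →+* AddMonoid.End (Fin n → F))

theorem actionHom_sigmaC (f : F) :
    actionHom τ Φ (sigmaC τ f) = Module.toAddMonoidEnd F (Fin n → F) f := by
  refine (SkewMonoidAlgebra.liftNC_single _ _ _ _).trans ?_
  rw [map_one, mul_one]
  rfl

theorem actionHom_sigma : actionHom τ Φ (sigma τ) = rowSigma τ Φ := by
  refine (SkewMonoidAlgebra.liftNC_single _ _ _ _).trans ?_
  rw [MonoidHom.comp_apply, sigmaHom_sigmaGen]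
  change Module.toAddMonoidEnd F (Fin n → F) 1 * rowSigma τ Φ = rowSigma τ Φ
  rw [map_one, one_mul]

/-- The left `F[σ, σ⁻¹]`-module structure. -/
instance : Module (TwistedLaurent τ) (ModuleOf τ Φ) :=
  Module.compHom (Fin n → F) (actionHom τ Φ)

theorem sigmaC_smul (f : F) (v : ModuleOf τ Φ) : sigmaC τ f • v = f • v := by
  change actionHom τ Φ (sigmaC τ f) v = _
  rw [actionHom_sigmaC]
  rfl

theorem sigma_smul (v : ModuleOf τ Φ) :
    sigma τ • v = (Matrix.vecMul (fun i => τ (v i)) Φ.1 : Fin n → F) := by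
  change actionHom τ Φ (sigma τ) v = _
  rw [actionHom_sigma]
  rfl

end ModuleOf

/-- The matrix `Φ` with `σ b = Φ b` representing multiplication by `σ` in the basis `b`. -/
def sigmaMatrix {M : Type*} [AddCommGroup M] [Module F M] [Module (TwistedLaurent τ) M]
    (b : Module.Basis (Fin n) F M) : Matrix (Fin n) (Fin n) F :=
  Matrix.of fun i j => b.repr (sigma τ • b i) j

theorem ModuleOf.sigmaMatrix_basis (Φ : GL (Fin n) F) :
    sigmaMatrix (τ := τ) (ModuleOf.basis Φ : Module.Basis (Fin n) F (ModuleOf τ Φ)) = Φ.1 := by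
  ext i j
  rw [sigmaMatrix, Matrix.of_apply, ModuleOf.sigma_smul]
  change Matrix.vecMul (fun l => τ (Pi.basisFun F (Fin n) i l)) Φ.1 j = Φ.1 i j
  have h : (fun l => τ (Pi.basisFun F (Fin n) i l)) = Pi.single i 1 := by
    funext l
    rw [Pi.basisFun_apply]
    by_cases hl : l = i
    · subst hl; simp
    · simp [hl]
  rw [h, Matrix.single_one_vecMul]
  rfl

end TwistedModules

section Motives

variable (Fq : Type*) [Field Fq] [Fintype Fq]

/-- The ring `k̄(t)[σ, σ⁻¹]` with `σ f = f^(-1) σ`. -/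
abbrev SigmaRing : Type _ := TwistedLaurent (F := RatFunc (KBar Fq)) (ratTwist (-1))

/-- A pre-`t`-motive: a left `k̄(t)[σ, σ⁻¹]`-module that is finite dimensional over `k̄(t)`. The
field `k̄(t)` acts through its inclusion in `k̄(t)[σ, σ⁻¹]`. -/
class IsPreTMotive (M : Type*) [AddCommGroup M] [Module (RatFunc (KBar Fq)) M]
    [Module (SigmaRing Fq) M] : Prop where
  sigmaC_smul : ∀ (f : RatFunc (KBar Fq)) (m : M), sigmaC (ratTwist (-1)) f • m = f • m
  finite : Module.Finite (RatFunc (KBar Fq)) M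

variable {Fq} {n : ℕ}

instance (Φ : GL (Fin n) (RatFunc (KBar Fq))) : IsPreTMotive Fq (ModuleOf (ratTwist (-1)) Φ) where
  sigmaC_smul := ModuleOf.sigmaC_smul Φ
  finite := Module.Finite.of_basis (ModuleOf.basis Φ)

/-- `Ψ ∈ GL_n(𝕃)` is a rigid analytic trivialization of `Φ` if `Ψ^(-1) = Φ Ψ`. -/
def IsRigidAnalyticTrivialization (Φ : Matrix (Fin n) (Fin n) (RatFunc (KBar Fq)))
    (Ψ : Matrix (Fin n) (Fin n) (LField Fq)) : Prop :=
  IsUnit Ψ ∧ Ψ.map (lTwistInv Fq) = Φ.map (ratToL Fq) * Ψ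

/-- The power series `f` converges at `t = x`. -/
def ConvergesAt (f : PowerSeries (CInf Fq)) (x : CInf Fq) : Prop :=
  Summable fun n => PowerSeries.coeff n f * x ^ n

/-- The value `f|_{t = x}`. -/
def evalAt (f : PowerSeries (CInf Fq)) (x : CInf Fq) : CInf Fq :=
  ∑' n, PowerSeries.coeff n f * x ^ n

/-- `x` is a period of `M`: an entry of `Ψ|_{t = θ}`, for a rigid analytic trivialization `Ψ` (with
respect to some basis of `M`) all of whose entries are power series in `𝕋` converging at
`t = θ`. -/
def IsPeriod (M : Type*) [AddCommGroup M] [Module (RatFunc (KBar Fq)) M]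
    [Module (SigmaRing Fq) M] (x : CInf Fq) : Prop :=
  ∃ (n : ℕ) (b : Module.Basis (Fin n) (RatFunc (KBar Fq)) M)
    (Ψ : Matrix (Fin n) (Fin n) (Tate Fq)),
    IsRigidAnalyticTrivialization (sigmaMatrix (τ := ratTwist (-1)) b)
      (Ψ.map (algebraMap (Tate Fq) (LField Fq))) ∧
    (∀ i j, ConvergesAt (Ψ i j : PowerSeries (CInf Fq)) (theta Fq)) ∧
    ∃ i j, x = evalAt (Ψ i j : PowerSeries (CInf Fq)) (theta Fq)

end Motives

section Series

variable (Fq : Type*) [Field Fq] [Fintype Fq]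

/-- `D_i = ∏_{j < i} (θ^(q^i) - θ^(q^j))` in `A = F_q[θ]`. -/
def carlitzD (i : ℕ) : Fq[X] :=
  ∏ j ∈ Finset.range i,
    (Polynomial.X ^ Fintype.card Fq ^ i - Polynomial.X ^ Fintype.card Fq ^ j)

/-- The Carlitz gamma `Γ_s = ∏_i D_i^(n_i)` for `s ≥ 1`, where `s - 1 = ∑ n_i q^i` is the `q`-adic
expansion (whose digits `n_i` vanish for `i ≥ s`). -/
def carlitzGamma (s : ℕ) : Fq[X] :=
  ∏ i ∈ Finset.range s, carlitzD Fq i ^ ((s - 1) / Fintype.card Fq ^ i % Fintype.card Fq)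

/-- The inclusion `A = F_q[θ] → ℂ_∞`. -/
def ofA : Fq[X] →+* CInf Fq :=
  (algebraMap (RatFunc Fq) (CInf Fq)).comp (algebraMap Fq[X] (RatFunc Fq))

/-- The inclusion `A = F_q[θ] → k̄`. -/
def ofABar : Fq[X] →+* KBar Fq :=
  (algebraMap (RatFunc Fq) (KBar Fq)).comp (algebraMap Fq[X] (RatFunc Fq))

/-- The power sum `S_d(s) = ∑ 1 / a^s`, over the monic `a ∈ A` of degree `d`. -/
def powerSum (d s : ℕ) : RatFunc Fq :=
  ∑ᶠ (a : Fq[X]) (_ : a.Monic ∧ a.natDegree = d), (algebraMap Fq[X] (RatFunc Fq) a ^ s)⁻¹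

variable {Fq}

/-- The polynomial `H ∈ A[t]` as a power series in `t` over `ℂ_∞`. -/
def toSeries (H : Fq[X][X]) : PowerSeries (CInf Fq) := (H.map (ofA Fq) : (CInf Fq)[X])

/-- The polynomial `H ∈ A[t]` as an element of `k̄(t)`. -/
def toRat (H : Fq[X][X]) : RatFunc (KBar Fq) :=
  algebraMap (KBar Fq)[X] (RatFunc (KBar Fq)) (H.map (ofABar Fq))

/-- The partial product `λ^(-q) ∏_{i=1}^N (1 - t / θ^(q^i))`. -/
def omegaPartial (lam : CInf Fq) (N : ℕ) : PowerSeries (CInf Fq) :=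
  PowerSeries.C ((lam ^ Fintype.card Fq)⁻¹) * ∏ i ∈ Finset.range N,
    (1 - PowerSeries.C ((theta Fq ^ Fintype.card Fq ^ (i + 1))⁻¹) * PowerSeries.X)

/-- `Ω = (-θ)^(-q/(q-1)) ∏_{i≥1} (1 - t / θ^(q^i))` (the coefficientwise limit of the partial
products), where `λ = (-θ)^(1/(q-1))` is a chosen root. -/
def omega (lam : CInf Fq) : PowerSeries (CInf Fq) :=
  PowerSeries.mk fun n => limUnder atTop fun N => PowerSeries.coeff n (omegaPartial lam N)

/-- The fundamental period `π̃ = 1 / Ω(θ)` of the Carlitz module that corresponds to `λ`. -/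
def piTilde (lam : CInf Fq) : CInf Fq := (evalAt (omega lam) (theta Fq))⁻¹

/-- The property characterising the Anderson–Thakur polynomial `H = H_{s-1}`, namely
`(H Ω^s)^(d)|_{t=θ} = Γ_s S_d(s) / π̃^s` for all `d ≥ 0`. -/
def IsAndersonThakur (lam : CInf Fq) (s : ℕ) (H : Fq[X][X]) : Prop :=
  ∀ d : ℕ, HasSum
    (fun n => PowerSeries.coeff n (twist (d : ℤ) (toSeries H * omega lam ^ s)) * theta Fq ^ n)
    (ofA Fq (carlitzGamma Fq s) * algebraMap (RatFunc Fq) (CInf Fq) (powerSum Fq d s) /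
      piTilde lam ^ s)

/-- The Anderson–Thakur polynomial `H_{s-1} ∈ A[t]`, for `s ≥ 1`. -/
def andersonThakur (lam : CInf Fq) (s : ℕ) : Fq[X][X] :=
  Classical.epsilon (IsAndersonThakur lam s)

/-- The index set of the alternating multizeta value: tuples `(a_1, …, a_r)` of monic polynomials
with `deg a_1 > ⋯ > deg a_r`. -/
def ZetaIndex (Fq : Type*) [Field Fq] (r : ℕ) : Type _ :=
  {a : Fin r → Fq[X] // (∀ i, (a i).Monic) ∧ StrictAnti fun i => (a i).natDegree}

/-- The term `∏ ε_i^(deg a_i) / a_i^(s_i)` in `k_∞`. -/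
def zetaTerm {r : ℕ} (s : Fin r → ℕ) (ε : Fin r → Fqˣ) (a : ZetaIndex Fq r) : KInf Fq :=
  algebraMap (RatFunc Fq) (KInf Fq)
    (∏ i, RatFunc.C (ε i : Fq) ^ (a.1 i).natDegree / algebraMap Fq[X] (RatFunc Fq) (a.1 i) ^ s i)

/-- The alternating multizeta value `ζ_A(s; ε) ∈ k_∞`. -/
def amzv {r : ℕ} (s : Fin r → ℕ) (ε : Fin r → Fqˣ) : KInf Fq := ∑' a, zetaTerm s ε a

/-- The term `∏_i ε_i^(d_i) (H_{s_i - 1} Ω^(s_i))^(d_i)` of the series `L(s; ε)`, the index `i`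
running over a finite linearly ordered set. -/
def lTerm {ι : Type*} [Fintype ι] (lam : CInf Fq) (s : ι → ℕ) (ε : ι → Fqˣ) (d : ι → ℕ) :
    PowerSeries (CInf Fq) :=
  ∏ i, (PowerSeries.C (algebraMap Fq (CInf Fq) (ε i : Fq) ^ d i) *
    twist (d i : ℤ) (toSeries (andersonThakur lam (s i)) * omega lam ^ s i))

/-- The series `L(s; ε) = ∑_{d_1 > ⋯ > d_r ≥ 0} ∏_i ε_i^(d_i) (H_{s_i - 1} Ω^(s_i))^(d_i)`, summed
coefficientwise. -/
def lSeries {ι : Type*} [Fintype ι] [LinearOrder ι] (lam : CInf Fq) (s : ι → ℕ) (ε : ι → Fqˣ) :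
    PowerSeries (CInf Fq) :=
  PowerSeries.mk fun n =>
    ∑' d : {d : ι → ℕ // StrictAnti d}, PowerSeries.coeff n (lTerm lam s ε d.1)

end Series

section Matrices

variable {Fq : Type*} [Field Fq] [Fintype Fq] {r : ℕ}

/-- `s_i + ⋯ + s_r`, where `i` is a row of an `(r+1) × (r+1)`-matrix (zero for the last row). -/
def tailWeight (s : Fin r → ℕ) (i : Fin (r + 1)) : ℕ :=
  ∑ m : Fin r with i ≤ m.castSucc, s m

/-- The indices `j, …, i - 1` of the entries of `(s_1, …, s_r)` that occur in row `i`, column `j`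
of `Ψ`. -/
abbrev Slice (i j : Fin (r + 1)) : Type := {m : Fin r // j ≤ m.castSucc ∧ m.castSucc < i}

/-- `t - θ` in `k̄(t)`. -/
def tSubTheta (Fq : Type*) [Field Fq] [Fintype Fq] : RatFunc (KBar Fq) :=
  RatFunc.X - RatFunc.C (thetaBar Fq)

/-- The matrix `Φ`: `(t-θ)^(s_i+⋯+s_r)` on the diagonal,
`γ_i^(-1) (t-θ)^(s_i+⋯+s_r) H_{s_i-1}^(-1)` just below it in column `i`, and zero elsewhere. -/
def phi (lam : CInf Fq) (s : Fin r → ℕ) (γ : Fin r → KBar Fq) :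
    Matrix (Fin (r + 1)) (Fin (r + 1)) (RatFunc (KBar Fq)) :=
  Matrix.of fun i j =>
    if i = j then tSubTheta Fq ^ tailWeight s i
    else if h : (i : ℕ) = j + 1 then
      ratTwist (-1) (RatFunc.C (γ ⟨j, by omega⟩)) * tSubTheta Fq ^ tailWeight s j *
        ratTwist (-1) (toRat (andersonThakur lam (s ⟨j, by omega⟩)))
    else 0

theorem tSubTheta_ne_zero : tSubTheta Fq ≠ 0 := by
  have h : tSubTheta Fq = algebraMap (KBar Fq)[X] (RatFunc (KBar Fq))
      (Polynomial.X - Polynomial.C (thetaBar Fq)) := by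
    simp [tSubTheta]
  rw [h]
  exact RatFunc.algebraMap_ne_zero (Polynomial.X_sub_C_ne_zero _)

theorem isUnit_phi (lam : CInf Fq) (s : Fin r → ℕ) (γ : Fin r → KBar Fq) :
    IsUnit (phi lam s γ) := by
  rw [Matrix.isUnit_iff_isUnit_det, Matrix.det_of_isLowerTriangular]
  · simp only [phi, Matrix.of_apply, if_true]
    exact (Finset.prod_ne_zero_iff.mpr fun i _ => pow_ne_zero _ tSubTheta_ne_zero).isUnit
  · intro i j hij
    have hij' : i < j := hij
    have h1 : i ≠ j := hij'.ne
    have h2 : ¬ (i : ℕ) = j + 1 := by omega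
    simp [phi, h1, h2]

/-- The pre-`t`-motive `M`, of dimension `r + 1`, with basis `m` such that `σ m = Φ m`. -/
abbrev Motive (lam : CInf Fq) (s : Fin r → ℕ) (γ : Fin r → KBar Fq) : Type _ :=
  ModuleOf (ratTwist (-1)) (isUnit_phi lam s γ).unit

/-- The matrix `Ψ`: lower triangular, with the entry
`γ_j ⋯ γ_{i-1} L(s_j, …, s_{i-1}) Ω^(s_i+⋯+s_r)` in row `i` and column `j ≤ i`. -/
def psi (lam : CInf Fq) (s : Fin r → ℕ) (ε : Fin r → Fqˣ) (γ : Fin r → KBar Fq) :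
    Matrix (Fin (r + 1)) (Fin (r + 1)) (PowerSeries (CInf Fq)) :=
  Matrix.of fun i j =>
    if j ≤ i then
      PowerSeries.C (∏ m : Slice i j, (γ m : CInf Fq)) *
        lSeries lam (fun m : Slice i j => s m) (fun m : Slice i j => ε m) *
        omega lam ^ tailWeight s i
    else 0

end Matrices

end AMZV

open AMZV

/-! The theorem rests on the functional equation of `Ω`, an explicit construction of the
Anderson–Thakur polynomials, and one estimate.

Since `λ^(q-1) = -θ`, the product satisfies `Ω^(-1) = (t-θ)Ω`. Iterating and putting `t = θ` gives
`Ω^(d)(θ) = 1/(π̃ ℓ_d)` with `ℓ_d = ∏_{1≤j≤d} (θ-θ^(q^j))`. Hence the property defining `H_{s-1}` is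
algebraic: under `θ ↦ θ^(q^d)`, `t ↦ θ` it must become `Γ_s ℓ_d^s S_d(s)` for every `d`
(`isAndersonThakur_iff`). Infinitely many specialisations determine a polynomial, whence uniqueness.
For existence, the Carlitz polynomial `E_d/D_d` is `1` at all monic `a` of degree `d`, so `1 -
E_d(ℓ_d x)/D_d` has exactly the roots `a/ℓ_d`. Its derivative is `-1`, so its reciprocal generates
the numbers `ℓ_d^n S_d(n)`. The resulting recursion lifts to `A[t]`, uniformly in `d`: its
coefficients are specialisations of `G_i/D_i`, those of `G_i` vanish for `d < i`, and the Carlitz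
gammas clear the denominators (`exists_andersonThakur`).

The construction also bounds `(q-1) deg_θ H_{s-1}` by `q(s-1)`. Against `|λ|^(-q)`, the size of `Ω`
on the disc of radius `q^q > |θ|`, this leaves a bound `|λ|^(-q) < 1` for `H_{s-1} Ω^s`, up to a
factor from powers of `t` that twisting does not raise. The twists therefore decay doubly
exponentially (`coeffBound_twist_andersonThakur`), which puts the series `L` in `𝕋` and allows
termwise evaluation at `θ`.

Splitting the sum for `L` according to whether the smallest index is zero expresses `L` through its
own first twist and that of the shorter series (`lSeries_eq`). The constants `ε` that appear are
absorbed by `γ`, because `ε γ^(-1) = γ`. This is `Ψ^(-1) = ΦΨ`. At `t = θ` the terms of `L` become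
products of power sums, and grouping the multizeta series by degrees identifies the lower left
entry. -/

namespace AMZV

open Filter Topology
open scoped NNReal Polynomial

/-! ### Carlitz factorials and their divisibility -/

section CarlitzFactorials

theorem X_pow_sub_X_pow_ne_zero (F : Type*) [Field F] {a b : ℕ} (h : a ≠ b) :
    (Polynomial.X ^ a - Polynomial.X ^ b : F[X]) ≠ 0 := by
  intro h0
  have := congrArg Polynomial.natDegree (sub_eq_zero.mp h0)
  simp only [Polynomial.natDegree_X_pow] at this
  exact h this

variable (Fq : Type*) [Field Fq] [Fintype Fq]

theorem sub_pow_card_pow {R : Type*} [CommRing R] [Algebra Fq R] (x y : R) (n : ℕ) :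
    (x - y) ^ Fintype.card Fq ^ n = x ^ Fintype.card Fq ^ n - y ^ Fintype.card Fq ^ n := by
  induction n with
  | zero => simp
  | succ n ih =>
    rw [pow_succ, pow_mul, ih, pow_mul, pow_mul]
    exact map_sub (FiniteField.frobeniusAlgHom Fq R) _ _

theorem sum_pow_card_pow {R ι : Type*} [CommRing R] [Algebra Fq R] (s : Finset ι) (f : ι → R)
    (n : ℕ) :
    (∑ i ∈ s, f i) ^ Fintype.card Fq ^ n = ∑ i ∈ s, f i ^ Fintype.card Fq ^ n := by
  induction n with
  | zero => simp
  | succ n ih =>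
    simp only [pow_succ (Fintype.card Fq), pow_mul]
    rw [ih]
    exact map_sum (FiniteField.frobeniusAlgHom Fq R) _ _

/-- `[i] = θ^(q^i) - θ`. -/
def bracket (i : ℕ) : Fq[X] := Polynomial.X ^ Fintype.card Fq ^ i - Polynomial.X

/-- The factor `j = 0` is the bracket; the factor `j + 1` is the `q`-th power of the factor `j` of
`D_i`, by Frobenius. -/
theorem carlitzD_succ (i : ℕ) :
    carlitzD Fq (i + 1) = bracket Fq (i + 1) * carlitzD Fq i ^ Fintype.card Fq := by
  rw [carlitzD, Finset.prod_range_succ', carlitzD, ← Finset.prod_pow, mul_comm]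
  congr 1
  · simp [bracket]
  · refine Finset.prod_congr rfl fun j _ => ?_
    have := sub_pow_card_pow Fq (Polynomial.X ^ Fintype.card Fq ^ i : Fq[X])
      (Polynomial.X ^ Fintype.card Fq ^ j) 1
    rw [pow_one] at this
    rw [this, ← pow_mul, ← pow_mul, ← pow_succ, ← pow_succ]

theorem card_pow_injective : Function.Injective fun i : ℕ => Fintype.card Fq ^ i :=
  Nat.pow_right_injective Fintype.one_lt_card

theorem bracket_ne_zero (i : ℕ) : bracket Fq (i + 1) ≠ 0 := by
  have h := X_pow_sub_X_pow_ne_zero Fq ((card_pow_injective Fq).ne (Nat.succ_ne_zero i))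
  simpa [bracket] using h

theorem carlitzD_ne_zero (i : ℕ) : carlitzD Fq i ≠ 0 :=
  Finset.prod_ne_zero_iff.mpr fun _ hj => X_pow_sub_X_pow_ne_zero Fq
    ((card_pow_injective Fq).ne (Finset.mem_range.mp hj).ne')

/-- Legendre's formula for the Carlitz factorial, truncated at `N`. -/
theorem prod_carlitzD_pow_digits (n N : ℕ) :
    (∏ i ∈ Finset.range N, carlitzD Fq i ^ (n / Fintype.card Fq ^ i % Fintype.card Fq)) *
        carlitzD Fq N ^ (n / Fintype.card Fq ^ N) =
      ∏ j ∈ Finset.range N, bracket Fq (j + 1) ^ (n / Fintype.card Fq ^ (j + 1)) := by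
  induction N with
  | zero => simp [carlitzD]
  | succ N ih =>
    rw [Finset.prod_range_succ, Finset.prod_range_succ, ← ih, carlitzD_succ, mul_pow, ← pow_mul,
      pow_succ, ← Nat.div_div_eq_div_mul]
    -- The exponent is its last `q`-adic digit plus `q` times the next quotient; the second part is
    -- what `D_(N+1) = [N+1] D_N^q` supplies.
    have h : carlitzD Fq N ^ (n / Fintype.card Fq ^ N) =
        carlitzD Fq N ^ (n / Fintype.card Fq ^ N % Fintype.card Fq) *
        carlitzD Fq N ^ (Fintype.card Fq * (n / Fintype.card Fq ^ N / Fintype.card Fq)) := by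
      rw [← pow_add, Nat.mod_add_div]
    rw [h]
    ring

theorem lt_card_pow_self (n : ℕ) : n < Fintype.card Fq ^ n :=
  Nat.lt_pow_self Fintype.one_lt_card

theorem prod_bracket_pow_eq {n N M : ℕ} (hN : n < Fintype.card Fq ^ (N + 1)) (hNM : N ≤ M) :
    ∏ j ∈ Finset.range M, bracket Fq (j + 1) ^ (n / Fintype.card Fq ^ (j + 1)) =
      ∏ j ∈ Finset.range N, bracket Fq (j + 1) ^ (n / Fintype.card Fq ^ (j + 1)) := by
  symm
  refine Finset.prod_subset (Finset.range_mono hNM) fun j _ hj => ?_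
  rw [Finset.mem_range, not_lt] at hj
  rw [Nat.div_eq_of_lt (hN.trans_le (Nat.pow_le_pow_right Fintype.card_pos (by omega))), pow_zero]

/-- The analogue of `v_p(n!) = ∑ ⌊n/p^j⌋`. Leaving `N` free lets several factorials be compared over
one common range. -/
theorem carlitzGamma_succ_eq {n N : ℕ} (h : n + 1 ≤ N) :
    carlitzGamma Fq (n + 1) =
      ∏ j ∈ Finset.range N, bracket Fq (j + 1) ^ (n / Fintype.card Fq ^ (j + 1)) := by
  have hlt : n < Fintype.card Fq ^ (n + 1) := (Nat.lt_succ_self n).trans (lt_card_pow_self Fq _)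
  rw [prod_bracket_pow_eq Fq (hlt.trans (Nat.pow_lt_pow_right Fintype.one_lt_card
    (Nat.lt_succ_self _))) h, ← prod_carlitzD_pow_digits, Nat.div_eq_of_lt hlt, pow_zero, mul_one]
  simp [carlitzGamma]

/-- `D_i` is the Carlitz factorial of `q^i`: the only nonzero digit of `q^i` is the `i`-th. -/
theorem carlitzD_eq {i N : ℕ} (h : i ≤ N) :
    carlitzD Fq i = ∏ j ∈ Finset.range N,
      bracket Fq (j + 1) ^ (Fintype.card Fq ^ i / Fintype.card Fq ^ (j + 1)) := by
  have hq : 0 < Fintype.card Fq := Fintype.card_pos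
  rw [prod_bracket_pow_eq Fq (Nat.pow_lt_pow_right Fintype.one_lt_card (Nat.lt_succ_self _)) h,
    ← prod_carlitzD_pow_digits, Nat.div_self (pow_pos hq _), pow_one, Finset.prod_eq_one, one_mul]
  intro j hj
  rw [Finset.mem_range] at hj
  rw [Nat.pow_div hj.le hq, Nat.mod_eq_zero_of_dvd, pow_zero]
  exact dvd_pow_self _ (by omega)

theorem carlitzGamma_one : carlitzGamma Fq 1 = 1 := by
  simp [carlitzGamma]

/-- Integrality of a Carlitz binomial coefficient. Bracket by bracket it is the superadditivity of
the floor, `⌊a/c⌋ + ⌊b/c⌋ ≤ ⌊(a+b)/c⌋`. -/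
theorem carlitzD_mul_carlitzGamma_dvd (i m : ℕ) :
    carlitzD Fq i * carlitzGamma Fq (m + 1) ∣ carlitzGamma Fq (m + Fintype.card Fq ^ i + 1) := by
  have h1 : i < Fintype.card Fq ^ i := lt_card_pow_self Fq i
  rw [carlitzGamma_succ_eq Fq (show m + 1 ≤ m + Fintype.card Fq ^ i + 1 by omega),
    carlitzGamma_succ_eq Fq le_rfl,
    carlitzD_eq Fq (show i ≤ m + Fintype.card Fq ^ i + 1 by omega), ← Finset.prod_mul_distrib]
  refine Finset.prod_dvd_prod_of_dvd _ _ fun j _ => ?_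
  rw [← pow_add]
  apply pow_dvd_pow
  rw [add_comm m]
  exact Nat.div_add_div_le_add_div

/-- `ℓ_d = ∏_{1 ≤ j ≤ d} (θ - θ^(q^j))`. -/
def carlitzL (d : ℕ) : Fq[X] :=
  ∏ j ∈ Finset.range d, (Polynomial.X - Polynomial.X ^ Fintype.card Fq ^ (j + 1))

theorem carlitzL_ne_zero (d : ℕ) : carlitzL Fq d ≠ 0 :=
  Finset.prod_ne_zero_iff.mpr fun _ _ => by
    rw [← neg_ne_zero, neg_sub]
    exact bracket_ne_zero Fq _

theorem carlitzL_pow (d i : ℕ) : carlitzL Fq d ^ Fintype.card Fq ^ i =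
    ∏ j ∈ Finset.range d, (Polynomial.X ^ Fintype.card Fq ^ i -
      Polynomial.X ^ Fintype.card Fq ^ (j + 1 + i)) := by
  rw [carlitzL, ← Finset.prod_pow]
  refine Finset.prod_congr rfl fun j _ => ?_
  rw [sub_pow_card_pow, ← pow_mul, ← pow_add]

end CarlitzFactorials

/-! ### Carlitz polynomials and their values at monic polynomials -/

section CarlitzPolynomials

variable (Fq : Type*) [Field Fq] [Fintype Fq]

/-- The `i`-th term of the Carlitz polynomial `E_d(x) / D_d`. -/
def carlitzTerm (d i : ℕ) (x : RatFunc Fq) : RatFunc Fq :=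
  x ^ Fintype.card Fq ^ i / (algebraMap Fq[X] (RatFunc Fq) (carlitzD Fq i) *
    algebraMap Fq[X] (RatFunc Fq) (carlitzL Fq (d - i)) ^ Fintype.card Fq ^ i)

/-- The normalised Carlitz polynomial `E_d(x) / D_d`, where `E_d(x) = ∏_{deg a < d} (x - a)`. -/
def carlitzE (d : ℕ) (x : RatFunc Fq) : RatFunc Fq :=
  ∑ i ∈ Finset.range (d + 1), carlitzTerm Fq d i x

variable {Fq}

/-- The bracket cancels against `D_(i+1) = [i+1] D_i^q`, which leaves the `q`-th power of the term
`i` at level `d`; the term `i = 0` dies because `[0] = 0`. -/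
theorem sum_bracket_mul_carlitzTerm (d : ℕ) (x : RatFunc Fq) :
    ∑ i ∈ Finset.range (d + 2),
        algebraMap Fq[X] (RatFunc Fq) (bracket Fq i) * carlitzTerm Fq (d + 1) i x =
      carlitzE Fq d x ^ Fintype.card Fq := by
  have h := sum_pow_card_pow Fq (Finset.range (d + 1)) (fun i => carlitzTerm Fq d i x) 1
  rw [pow_one] at h
  rw [Finset.sum_range_succ', carlitzE, h]
  simp only [bracket, pow_zero, pow_one, sub_self, map_zero, zero_mul, add_zero]
  refine Finset.sum_congr rfl fun i _ => ?_
  have hb := RatFunc.algebraMap_ne_zero (bracket_ne_zero Fq i)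
  rw [carlitzTerm, carlitzTerm, carlitzD_succ, Nat.add_sub_add_right, div_pow, mul_pow, ← pow_mul,
    ← pow_mul, ← pow_succ, map_mul, map_pow, mul_assoc, ← mul_div_assoc]
  exact mul_div_mul_left _ _ hb

/-- Multiplication of `x` by `θ` multiplies the `i`-th term by `θ^(q^i) = θ + [i]`. -/
theorem carlitzE_X_mul (d : ℕ) (x : RatFunc Fq) :
    carlitzE Fq (d + 1) (RatFunc.X * x) =
      RatFunc.X * carlitzE Fq (d + 1) x + carlitzE Fq d x ^ Fintype.card Fq := by
  rw [← sum_bracket_mul_carlitzTerm, carlitzE, carlitzE, Finset.mul_sum, ← Finset.sum_add_distrib]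
  refine Finset.sum_congr rfl fun i _ => ?_
  simp only [carlitzTerm, bracket, map_sub, map_pow, RatFunc.algebraMap_X, mul_pow]
  ring

/-- Write `[d+1] = [i] + [d+1-i]^(q^i)` in the `i`-th term. The parts with `[i]` sum to the `q`-th
power; in the others the second summand cancels, up to sign, the last factor of `ℓ_(d+1-i)^(q^i)`.
-/
theorem bracket_mul_carlitzE (d : ℕ) (x : RatFunc Fq) :
    algebraMap Fq[X] (RatFunc Fq) (bracket Fq (d + 1)) * carlitzE Fq (d + 1) x =
      carlitzE Fq d x ^ Fintype.card Fq - carlitzE Fq d x := by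
  rw [← sum_bracket_mul_carlitzTerm, carlitzE, Finset.sum_range_succ,
    Finset.sum_range_succ _ (d + 1), carlitzE, mul_add, Finset.mul_sum, add_sub_right_comm,
    ← Finset.sum_sub_distrib]
  congr 1
  refine Finset.sum_congr rfl fun i hi => ?_
  have hi : i ≤ d := Nat.lt_succ_iff.mp (Finset.mem_range.mp hi)
  have hD := RatFunc.algebraMap_ne_zero (carlitzD_ne_zero Fq i)
  have hL := RatFunc.algebraMap_ne_zero (carlitzL_ne_zero Fq (d - i))
  have hb := RatFunc.algebraMap_ne_zero (bracket_ne_zero Fq (d - i))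
  have h1 : carlitzL Fq (d + 1 - i) = carlitzL Fq (d - i) * -bracket Fq (d - i + 1) := by
    rw [show d + 1 - i = d - i + 1 by omega, carlitzL, Finset.prod_range_succ, carlitzL, bracket,
      neg_sub]
  have h2 : bracket Fq (d + 1) =
      bracket Fq i - (-bracket Fq (d - i + 1)) ^ Fintype.card Fq ^ i := by
    rw [bracket, bracket, bracket, neg_sub, sub_pow_card_pow, ← pow_mul, ← pow_add,
      show d - i + 1 + i = d + 1 by omega]
    ring
  have hb' : algebraMap Fq[X] (RatFunc Fq) (-bracket Fq (d - i + 1)) ≠ 0 := by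
    rw [map_neg]; exact neg_ne_zero.mpr hb
  rw [carlitzTerm, carlitzTerm, h1, h2, map_mul, mul_pow, map_sub, map_pow]
  have h3 := pow_ne_zero (Fintype.card Fq ^ i) hb'
  have h4 := pow_ne_zero (Fintype.card Fq ^ i) hL
  generalize algebraMap Fq[X] (RatFunc Fq) (-bracket Fq (d - i + 1)) ^ Fintype.card Fq ^ i = B at *
  generalize algebraMap Fq[X] (RatFunc Fq) (carlitzL Fq (d - i)) ^ Fintype.card Fq ^ i = L at *
  field_simp

theorem carlitzE_sum {ι : Type*} (d : ℕ) (s : Finset ι) (f : ι → RatFunc Fq) :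
    carlitzE Fq d (∑ j ∈ s, f j) = ∑ j ∈ s, carlitzE Fq d (f j) := by
  simp only [carlitzE, carlitzTerm]
  rw [Finset.sum_comm]
  refine Finset.sum_congr rfl fun i _ => ?_
  rw [sum_pow_card_pow, Finset.sum_div]

theorem carlitzE_C_mul (d : ℕ) (c : Fq) (x : RatFunc Fq) :
    carlitzE Fq d (RatFunc.C c * x) = RatFunc.C c * carlitzE Fq d x := by
  simp only [carlitzE, carlitzTerm, Finset.mul_sum]
  refine Finset.sum_congr rfl fun i _ => ?_
  rw [mul_pow, ← map_pow, FiniteField.pow_card_pow, mul_div_assoc]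

theorem carlitzE_X_pow (d j : ℕ) (hj : j ≤ d) :
    carlitzE Fq d (RatFunc.X ^ j) = if j = d then 1 else 0 := by
  -- The value at `1` starts as `1` for `d = 0`; afterwards `[d+1] E_(d+1)(1)/D_(d+1) = y^q - y`
  -- with `y ∈ {0, 1}`, hence zero.
  have hE1 : ∀ d, carlitzE Fq d 1 = if 0 = d then 1 else 0 := by
    intro d
    induction d with
    | zero => simp [carlitzE, carlitzTerm, carlitzD, carlitzL]
    | succ d ih =>
      have h := bracket_mul_carlitzE d (1 : RatFunc Fq)
      have h0 : carlitzE Fq d 1 ^ Fintype.card Fq - carlitzE Fq d 1 = 0 := by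
        rw [ih]
        split_ifs <;> simp
      rw [h0] at h
      rw [if_neg (by omega)]
      exact (mul_eq_zero.mp h).resolve_left (RatFunc.algebraMap_ne_zero (bracket_ne_zero Fq d))
  induction j generalizing d with
  | zero => simpa using hE1 d
  | succ j ih =>
    obtain ⟨d, rfl⟩ : ∃ e, d = e + 1 := ⟨d - 1, by omega⟩
    rw [pow_succ', carlitzE_X_mul, ih (d + 1) (by omega), ih d (by omega), if_neg (by omega)]
    by_cases h : j = d
    · simp [h]
    · simp [h]

/-- By `F_q`-linearity only the leading term contributes: the function kills `θ^j` for `j < d` and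
is `1` at `θ^d`. -/
theorem carlitzE_monic {a : Fq[X]} (ha : a.Monic) :
    carlitzE Fq a.natDegree (algebraMap Fq[X] (RatFunc Fq) a) = 1 := by
  conv_lhs => rw [a.as_sum_range_C_mul_X_pow, map_sum, carlitzE_sum]
  rw [Finset.sum_range_succ, Finset.sum_eq_zero, zero_add]
  · rw [map_mul, map_pow, RatFunc.algebraMap_C, RatFunc.algebraMap_X, carlitzE_C_mul]
    rw [← a.as_sum_range_C_mul_X_pow]
    rw [carlitzE_X_pow _ _ le_rfl, ha.coeff_natDegree]
    simp
  · intro j hj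
    rw [Finset.mem_range] at hj
    rw [map_mul, map_pow, RatFunc.algebraMap_C, RatFunc.algebraMap_X, carlitzE_C_mul]
    rw [← a.as_sum_range_C_mul_X_pow]
    rw [carlitzE_X_pow _ _ hj.le, if_neg hj.ne, mul_zero]

end CarlitzPolynomials

/-! ### Generating series and recursion for the power sums -/

section PowerSums

/-- If the nonzero `r i` are all the roots of `Q` and `Q' = -1`, then `1 / Q` is the generating
series of the power sums of the inverses of the `r i`. -/
theorem mk_sum_inv_pow_mul {K ι : Type*} [Field K] [Fintype ι] {r : ι → K}
    (hr : Function.Injective r) (h0 : ∀ i, r i ≠ 0) {Q : K[X]}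
    (hQ : Polynomial.derivative Q = -1) (hdeg : Q.natDegree ≤ Fintype.card ι)
    (hroot : ∀ i, Q.eval (r i) = 0) :
    (PowerSeries.mk fun n => ∑ i, ((r i)⁻¹) ^ (n + 1)) * (Q : PowerSeries K) = 1 := by
  classical
  have hQ0 : Q ≠ 0 := by
    rintro rfl
    simp at hQ
  -- The roots are distinct, so the product of the linear factors divides `Q`; the degree bound then
  -- forces the cofactor to be a constant `c`.
  obtain ⟨R, hR⟩ : ∏ i, (Polynomial.X - Polynomial.C (r i)) ∣ Q :=
    Finset.prod_dvd_of_coprime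
      (fun i _ j _ hij => Polynomial.pairwise_coprime_X_sub_C hr hij)
      fun i _ => Polynomial.dvd_iff_isRoot.mpr (hroot i)
  have hR0 : R ≠ 0 := by
    rintro rfl
    exact hQ0 (by rw [hR, mul_zero])
  have hmon : (∏ i, (Polynomial.X - Polynomial.C (r i))).Monic :=
    Polynomial.monic_prod_of_monic _ _ fun i _ => Polynomial.monic_X_sub_C _
  have hRdeg : R.natDegree = 0 := by
    have h := congrArg Polynomial.natDegree hR
    rw [hmon.natDegree_mul' hR0, Polynomial.natDegree_finsetProd_X_sub_C_eq_card,
      Finset.card_univ] at h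
    omega
  obtain ⟨c, rfl⟩ := Polynomial.natDegree_eq_zero.mp hRdeg
  -- Geometric series: `∑ r^(-n-1) X^n = -1/(X - r)`.
  have hgeom : ∀ i, (PowerSeries.mk fun n => ((r i)⁻¹) ^ (n + 1)) *
      ((Polynomial.X - Polynomial.C (r i) : K[X]) : PowerSeries K) = -1 := by
    intro i
    ext n
    rw [Polynomial.coe_sub, Polynomial.coe_X, Polynomial.coe_C, mul_sub, map_sub,
      PowerSeries.coeff_mul_C, PowerSeries.coeff_mk, map_neg]
    cases n with
    | zero => simp [h0 i]
    | succ n =>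
      rw [PowerSeries.coeff_succ_mul_X, PowerSeries.coeff_mk, pow_succ _ (n + 1), mul_assoc,
        inv_mul_cancel₀ (h0 i)]
      simp [PowerSeries.coeff_one]
  have hsum : (PowerSeries.mk fun n => ∑ i, ((r i)⁻¹) ^ (n + 1)) =
      ∑ i, PowerSeries.mk fun n => ((r i)⁻¹) ^ (n + 1) := by
    ext n
    simp
  have hder : (Polynomial.derivative Q : PowerSeries K) =
      ∑ i, ((∏ j ∈ Finset.univ.erase i, (Polynomial.X - Polynomial.C (r j)) : K[X]) :
        PowerSeries K) * (Polynomial.C c : K[X]) := by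
    rw [hR, Polynomial.derivative_mul, Polynomial.derivative_C, mul_zero, add_zero,
      Polynomial.derivative_prod_finset, Finset.sum_mul]
    simp only [Polynomial.derivative_X_sub_C, mul_one]
    rw [← Polynomial.coeToPowerSeries.ringHom_apply, map_sum]
    simp
  -- Logarithmic derivative: `∑ -1/(X - r_i) = -Q'/Q`, and `-Q' = 1`.
  calc _ = ∑ i, (PowerSeries.mk fun n => ((r i)⁻¹) ^ (n + 1)) * (Q : PowerSeries K) := by
        rw [hsum, Finset.sum_mul]
    _ = ∑ i, -(((∏ j ∈ Finset.univ.erase i, (Polynomial.X - Polynomial.C (r j)) : K[X]) :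
        PowerSeries K) * (Polynomial.C c : K[X])) := by
        refine Finset.sum_congr rfl fun i _ => ?_
        rw [hR, ← Finset.mul_prod_erase Finset.univ _ (Finset.mem_univ i), mul_assoc,
          Polynomial.coe_mul, ← mul_assoc, hgeom, Polynomial.coe_mul]
        ring
    _ = 1 := by
        rw [Finset.sum_neg_distrib, ← hder, hQ]
        simp

variable (Fq : Type*) [Field Fq] [Fintype Fq]

/-- The monic polynomials of degree `d`. -/
abbrev MonicOfDegree (d : ℕ) : Type _ := {a : Fq[X] // a.Monic ∧ a.natDegree = d}

/-- A monic polynomial of degree `d` is determined by its `d` lower coefficients. -/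
def monicEquiv (d : ℕ) : MonicOfDegree Fq d ≃ (Fin d → Fq) :=
  (Polynomial.monicEquivDegreeLT d).trans (Polynomial.degreeLTEquiv Fq d).toEquiv

instance (d : ℕ) : Fintype (MonicOfDegree Fq d) := by
  classical exact Fintype.ofEquiv _ (monicEquiv Fq d).symm

theorem card_monicOfDegree (d : ℕ) : Fintype.card (MonicOfDegree Fq d) = Fintype.card Fq ^ d := by
  classical
  rw [Fintype.card_congr (monicEquiv Fq d), Fintype.card_fun, Fintype.card_fin]

theorem powerSum_eq (d s : ℕ) : powerSum Fq d s =
    ∑ a : MonicOfDegree Fq d, (algebraMap Fq[X] (RatFunc Fq) a.1 ^ s)⁻¹ := by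
  rw [powerSum, ← finsum_eq_sum_of_fintype]
  exact (finsum_subtype_eq_finsum_cond (f := fun a : Fq[X] =>
    (algebraMap Fq[X] (RatFunc Fq) a ^ s)⁻¹) (fun a => a.Monic ∧ a.natDegree = d)).symm

/-- `ℓ_d` in `k`. -/
def ratL (d : ℕ) : RatFunc Fq := algebraMap Fq[X] (RatFunc Fq) (carlitzL Fq d)

theorem ratL_ne_zero (d : ℕ) : ratL Fq d ≠ 0 := RatFunc.algebraMap_ne_zero (carlitzL_ne_zero Fq d)

/-- The polynomial `1 - E_d(ℓ_d x) / D_d`, which vanishes at `a / ℓ_d` for `a` monic of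
degree `d`. -/
def powerSumDenom (d : ℕ) : (RatFunc Fq)[X] :=
  1 - ∑ i ∈ Finset.range (d + 1), Polynomial.C (carlitzTerm Fq d i (ratL Fq d)) *
    Polynomial.X ^ Fintype.card Fq ^ i

/-- In characteristic `p` only the exponent `q^0 = 1` survives. Its coefficient is `ℓ_d/(D_0 ℓ_d) =
1`, which is the reason for rescaling by `ℓ_d`. -/
theorem derivative_powerSumDenom (d : ℕ) : Polynomial.derivative (powerSumDenom Fq d) = -1 := by
  have hq : ((Fintype.card Fq : ℕ) : (RatFunc Fq)[X]) = 0 := by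
    have h := congrArg (algebraMap Fq (RatFunc Fq)[X]) (FiniteField.cast_card_eq_zero Fq)
    rwa [map_natCast, map_zero] at h
  rw [powerSumDenom, map_sub, Polynomial.derivative_one, map_sum, Finset.sum_range_succ',
    Finset.sum_eq_zero, zero_add, pow_zero, pow_one, Polynomial.derivative_C_mul,
    Polynomial.derivative_X, mul_one, zero_sub]
  · congr 1
    have h := RatFunc.algebraMap_ne_zero (carlitzL_ne_zero Fq d)
    simp [carlitzTerm, ratL, carlitzD, h]
  · intro i _
    rw [Polynomial.derivative_C_mul, Polynomial.derivative_X_pow, Nat.cast_pow, map_pow]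
    simp [hq]

/-- There are `q^d` monic polynomials of degree `d`, as many as the degree of the denominator allows
roots, so the numbers `a/ℓ_d` exhaust them. -/
theorem mk_powerSum_mul (d : ℕ) :
    (PowerSeries.mk fun n => ratL Fq d ^ (n + 1) * powerSum Fq d (n + 1)) *
      (powerSumDenom Fq d : PowerSeries (RatFunc Fq)) = 1 := by
  have hl := ratL_ne_zero Fq d
  have ha : ∀ a : MonicOfDegree Fq d, algebraMap Fq[X] (RatFunc Fq) a.1 ≠ 0 := fun a =>
    RatFunc.algebraMap_ne_zero a.2.1.ne_zero
  have key := mk_sum_inv_pow_mul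
    (r := fun a : MonicOfDegree Fq d => algebraMap Fq[X] (RatFunc Fq) a.1 / ratL Fq d)
    (Q := powerSumDenom Fq d) ?_ (fun a => div_ne_zero (ha a) hl) (derivative_powerSumDenom Fq d)
    ?_ ?_
  · rw [← key]
    congr 2
    funext n
    rw [powerSum_eq, Finset.mul_sum]
    refine Finset.sum_congr rfl fun a _ => ?_
    rw [inv_div, div_pow, div_eq_mul_inv]
  · intro a b hab
    exact Subtype.ext (RatFunc.algebraMap_injective Fq ((div_left_inj' hl).mp hab))
  · rw [card_monicOfDegree]
    refine (Polynomial.natDegree_sub_le_of_le Polynomial.natDegree_one.le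
      (Polynomial.natDegree_sum_le_of_forall_le _ _ fun i hi =>
        (Polynomial.natDegree_C_mul_X_pow_le _ _).trans (Nat.pow_le_pow_right Fintype.card_pos
          (Nat.lt_succ_iff.mp (Finset.mem_range.mp hi))))).trans ?_
    simp
  · rintro ⟨a, hm, rfl⟩
    rw [powerSumDenom, Polynomial.eval_sub, Polynomial.eval_one, Polynomial.eval_finsetSum,
      sub_eq_zero]
    refine (carlitzE_monic hm).symm.trans (Finset.sum_congr rfl fun i _ => ?_)
    have h := pow_ne_zero (Fintype.card Fq ^ i) hl
    rw [Polynomial.eval_mul, Polynomial.eval_C, Polynomial.eval_pow, Polynomial.eval_X,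
      carlitzTerm, carlitzTerm, div_pow]
    field_simp

/-- The recursion for the normalised power sums `ℓ_d^n S_d(n)`. -/
theorem powerSum_recursion (d n : ℕ) :
    ratL Fq d ^ (n + 1) * powerSum Fq d (n + 1) = (if n = 0 then 1 else 0) +
      ∑ i ∈ Finset.range (d + 1), if Fintype.card Fq ^ i ≤ n then
        carlitzTerm Fq d i (ratL Fq d) * (ratL Fq d ^ (n - Fintype.card Fq ^ i + 1) *
          powerSum Fq d (n - Fintype.card Fq ^ i + 1)) else 0 := by
  -- The constant term `1` of the denominator isolates the `n`-th coefficient; each monomial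
  -- `X^(q^i)` contributes the coefficient of index `n - q^i`.
  have h := congrArg (PowerSeries.coeff n) (mk_powerSum_mul Fq d)
  rw [powerSumDenom, Polynomial.coe_sub, Polynomial.coe_one, mul_sub, mul_one, map_sub,
    PowerSeries.coeff_mk, PowerSeries.coeff_one, sub_eq_iff_eq_add] at h
  rw [h, ← Polynomial.coeToPowerSeries.ringHom_apply, map_sum, Finset.mul_sum, map_sum]
  congr 1
  refine Finset.sum_congr rfl fun i _ => ?_
  rw [Polynomial.coeToPowerSeries.ringHom_apply, Polynomial.coe_mul, Polynomial.coe_pow,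
    Polynomial.coe_C, Polynomial.coe_X, ← mul_assoc,
    PowerSeries.coeff_mul_X_pow']
  split_ifs with h1
  · rw [PowerSeries.coeff_mul_C, PowerSeries.coeff_mk, mul_comm]
  · rfl

end PowerSums

/-! ### Degree in `θ` of polynomials in `A[t]` -/

section InnerDegree

variable {F : Type*} [Field F]

/-- `c` times the degree in `θ` of `H ∈ F[θ][t]` is at most `b`. -/
def InnerDegreeLE (c : ℕ) (H : F[X][X]) (b : ℕ) : Prop :=
  ∀ k, c * (H.coeff k).natDegree ≤ b

theorem InnerDegreeLE.mono {c : ℕ} {H : F[X][X]} {b b' : ℕ} (h : InnerDegreeLE c H b)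
    (hb : b ≤ b') : InnerDegreeLE c H b' := fun k => (h k).trans hb

theorem innerDegreeLE_iff {c : ℕ} (hc : 0 < c) {H : F[X][X]} {b : ℕ} :
    InnerDegreeLE c H b ↔ ∀ k, (H.coeff k).natDegree ≤ b / c := by
  simp only [InnerDegreeLE, Nat.le_div_iff_mul_le hc, mul_comm c]

theorem InnerDegreeLE.sum {c : ℕ} (hc : 0 < c) {ι : Type*} {s : Finset ι} {f : ι → F[X][X]} {b : ℕ}
    (h : ∀ i ∈ s, InnerDegreeLE c (f i) b) : InnerDegreeLE c (∑ i ∈ s, f i) b := by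
  rw [innerDegreeLE_iff hc]
  intro k
  rw [Polynomial.finsetSum_coeff]
  exact Polynomial.natDegree_sum_le_of_forall_le _ _ fun i hi =>
    (innerDegreeLE_iff hc).mp (h i hi) k

theorem InnerDegreeLE.mul {c : ℕ} (hc : 0 < c) {G H : F[X][X]} {a b : ℕ}
    (hG : InnerDegreeLE c G a) (hH : InnerDegreeLE c H b) : InnerDegreeLE c (G * H) (a + b) := by
  intro k
  rw [Polynomial.coeff_mul, mul_comm, ← Nat.le_div_iff_mul_le hc]
  refine Polynomial.natDegree_sum_le_of_forall_le _ _ fun x _ => ?_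
  rw [Nat.le_div_iff_mul_le hc, mul_comm]
  calc c * _ ≤ c * ((G.coeff x.1).natDegree + (H.coeff x.2).natDegree) :=
        Nat.mul_le_mul_left _ Polynomial.natDegree_mul_le
    _ ≤ a + b := by rw [mul_add]; exact add_le_add (hG _) (hH _)

theorem innerDegreeLE_map_C (c : ℕ) (p : F[X]) : InnerDegreeLE c (p.map Polynomial.C) 0 := by
  intro k
  simp

end InnerDegree

/-! ### Construction of the Anderson–Thakur polynomials -/

section AndersonThakur

variable (Fq : Type*) [Field Fq] [Fintype Fq]

/-- The specialisation of `H ∈ A[t]` at `t = θ` after a `d`-fold twist: `θ ↦ θ^(q^d)`, `t ↦ θ`. -/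
def twistEval (d : ℕ) : Fq[X][X] →+* Fq[X] :=
  Polynomial.eval₂RingHom (Polynomial.expand Fq (Fintype.card Fq ^ d) : Fq[X] →+* Fq[X])
    Polynomial.X

variable {Fq} in
theorem twistEval_C (d : ℕ) (p : Fq[X]) :
    twistEval Fq d (Polynomial.C p) = Polynomial.expand Fq (Fintype.card Fq ^ d) p := by
  simp [twistEval]

theorem twistEval_X (d : ℕ) : twistEval Fq d Polynomial.X = Polynomial.X := by
  simp [twistEval]

variable {Fq} in
theorem twistEval_map_C (d : ℕ) (p : Fq[X]) : twistEval Fq d (p.map Polynomial.C) = p := by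
  rw [twistEval, Polynomial.coe_eval₂RingHom, Polynomial.eval₂_map]
  have h : (Polynomial.expand Fq (Fintype.card Fq ^ d) : Fq[X] →+* Fq[X]).comp Polynomial.C =
      Polynomial.C := by
    ext1 x
    simp
  rw [h, Polynomial.eval₂_C_X]

-- With the roles of `θ` and `t` exchanged, the specialisations are evaluations at the pairwise
-- distinct points `θ^(q^d)`, so the exchanged polynomial has infinitely many roots.
variable {Fq} in
theorem eq_zero_of_twistEval {G : Fq[X][X]} (h : ∀ d, twistEval Fq d G = 0) : G = 0 := by
  have key : ∀ d, (Polynomial.evalRingHom (Polynomial.X ^ Fintype.card Fq ^ d : Fq[X])).comp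
      (Polynomial.Bivariate.swap (R := Fq) : Fq[X][X] →+* Fq[X][X]) = twistEval Fq d := by
    intro d
    apply Polynomial.ringHom_ext'
    · apply Polynomial.ringHom_ext'
      · ext1 x
        simp [twistEval, Polynomial.Bivariate.swap_apply]
      · simp [twistEval, Polynomial.Bivariate.swap_apply]
    · simp [twistEval, Polynomial.Bivariate.swap_apply]
  have h0 : Polynomial.Bivariate.swap (R := Fq) G = 0 := by
    refine Polynomial.eq_zero_of_infinite_isRoot _ (Set.infinite_of_injective_forall_mem
      (f := fun d : ℕ => (Polynomial.X ^ Fintype.card Fq ^ d : Fq[X])) ?_ fun d => ?_)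
    · intro a b hab
      by_contra hne
      exact X_pow_sub_X_pow_ne_zero Fq ((card_pow_injective Fq).ne hne) (sub_eq_zero.mpr hab)
    · have := RingHom.congr_fun (key d) G
      rw [h d] at this
      exact this
  simpa using h0

/-- `G_i = ∏_{1 ≤ j ≤ i} (t^(q^i) - θ^(q^j))`. -/
def thakurG (i : ℕ) : Fq[X][X] :=
  ∏ j ∈ Finset.range i, (Polynomial.X ^ Fintype.card Fq ^ i -
    Polynomial.C (Polynomial.X ^ Fintype.card Fq ^ (j + 1)))

theorem twistEval_thakurG (d i : ℕ) : twistEval Fq d (thakurG Fq i) =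
    ∏ j ∈ Finset.range i, (Polynomial.X ^ Fintype.card Fq ^ i -
      Polynomial.X ^ Fintype.card Fq ^ (d + j + 1)) := by
  rw [thakurG, map_prod]
  refine Finset.prod_congr rfl fun j _ => ?_
  rw [map_sub, map_pow, twistEval_X, twistEval_C, map_pow, Polynomial.expand_X, ← pow_mul,
    ← pow_add, add_assoc]

/-- One factor becomes `θ^(q^i) - θ^(q^i)`. This is how a sum independent of `d` reproduces a
recursion that stops at `i = d`. -/
theorem twistEval_thakurG_of_lt {d i : ℕ} (h : d < i) : twistEval Fq d (thakurG Fq i) = 0 := by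
  rw [twistEval_thakurG]
  refine Finset.prod_eq_zero (i := i - d - 1) (Finset.mem_range.mpr (by omega)) ?_
  rw [show d + (i - d - 1) + 1 = i by omega, sub_self]

/-- The first `d - i` factors of `ℓ_d^(q^i)` form `ℓ_(d-i)^(q^i)`; the last `i` factors are the
specialisation of `G_i`. -/
theorem twistEval_thakurG_of_le {d i : ℕ} (h : i ≤ d) :
    algebraMap Fq[X] (RatFunc Fq) (twistEval Fq d (thakurG Fq i)) =
      algebraMap Fq[X] (RatFunc Fq) (carlitzD Fq i) * carlitzTerm Fq d i (ratL Fq d) := by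
  have hD := RatFunc.algebraMap_ne_zero (carlitzD_ne_zero Fq i)
  have hL := RatFunc.algebraMap_ne_zero (pow_ne_zero (Fintype.card Fq ^ i)
    (carlitzL_ne_zero Fq (d - i)))
  have key : carlitzL Fq d ^ Fintype.card Fq ^ i =
      carlitzL Fq (d - i) ^ Fintype.card Fq ^ i * twistEval Fq d (thakurG Fq i) := by
    rw [carlitzL_pow, carlitzL_pow, twistEval_thakurG]
    conv_lhs => rw [← Nat.sub_add_cancel h, Finset.prod_range_add]
    congr 1
    refine Finset.prod_congr rfl fun j _ => ?_
    rw [show d - i + j + 1 + i = d + j + 1 by omega]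
  rw [carlitzTerm, ratL, ← map_pow, key, map_mul, ← map_pow, mul_div_mul_comm, ← mul_assoc]
  field_simp

theorem innerDegreeLE_thakurG (i : ℕ) : InnerDegreeLE (Fintype.card Fq - 1) (thakurG Fq i)
    (Fintype.card Fq * Fintype.card Fq ^ i) := by
  have hq : 0 < Fintype.card Fq - 1 := Nat.sub_pos_of_lt Fintype.one_lt_card
  -- The exponent of `t` is decoupled from the number of factors, so that induction on the latter is
  -- possible.
  have key : ∀ n m : ℕ, InnerDegreeLE (Fintype.card Fq - 1) (∏ j ∈ Finset.range n,
      ((Polynomial.X ^ m : Fq[X][X]) - Polynomial.C (Polynomial.X ^ Fintype.card Fq ^ (j + 1))))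
      (∑ j ∈ Finset.range n, (Fintype.card Fq - 1) * Fintype.card Fq ^ (j + 1)) := by
    intro n m
    induction n with
    | zero => intro k; simp [Polynomial.coeff_one, apply_ite]
    | succ n ih =>
      rw [Finset.prod_range_succ, Finset.sum_range_succ]
      refine ih.mul hq fun k => Nat.mul_le_mul_left _ ?_
      rw [Polynomial.coeff_sub]
      refine Polynomial.natDegree_sub_le_of_le ?_ ?_ |>.trans (max_self _).le
      · rw [Polynomial.coeff_X_pow]
        split_ifs <;> simp
      · rw [Polynomial.coeff_C]
        split_ifs <;> simp
  refine (key i _).mono ?_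
  have hgeom : ∀ n, (∑ j ∈ Finset.range n, (Fintype.card Fq - 1) * Fintype.card Fq ^ (j + 1)) ≤
      Fintype.card Fq * Fintype.card Fq ^ n := by
    intro n
    induction n with
    | zero => simp
    | succ n ih =>
      rw [Finset.sum_range_succ]
      refine (Nat.add_le_add_right ih _).trans ?_
      rw [← pow_succ', add_comm, ← Nat.succ_mul, Nat.succ_eq_add_one,
        Nat.sub_add_cancel Fintype.card_pos]
  exact hgeom i

/-- Existence of the Anderson–Thakur polynomial `H_n`, with Anderson and Thakur's bound on its
degree in `θ`. -/
theorem exists_andersonThakur (n : ℕ) : ∃ H : Fq[X][X],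
    InnerDegreeLE (Fintype.card Fq - 1) H (Fintype.card Fq * n) ∧
    ∀ d, algebraMap Fq[X] (RatFunc Fq) (twistEval Fq d H) =
      algebraMap Fq[X] (RatFunc Fq) (carlitzGamma Fq (n + 1)) *
        (ratL Fq d ^ (n + 1) * powerSum Fq d (n + 1)) := by
  have hq : 0 < Fintype.card Fq - 1 := Nat.sub_pos_of_lt Fintype.one_lt_card
  induction n using Nat.strong_induction_on with
  | _ n ih =>
    rcases Nat.eq_zero_or_pos n with rfl | hn
    · refine ⟨1, fun k => by simp [Polynomial.coeff_one, apply_ite], fun d => ?_⟩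
      rw [powerSum_recursion, Finset.sum_eq_zero]
      · simp [carlitzGamma_one]
      · intro i _
        rw [if_neg (not_le.mpr (pow_pos Fintype.card_pos i))]
    choose! H hH1 hH2 using ih
    -- The cofactor `c_i = Γ_(n+1)/(D_i Γ_(n-q^i+1))` clears the denominators of the `i`-th term of
    -- the recursion.
    have hdvd : ∀ i, ∃ c, Fintype.card Fq ^ i ≤ n → carlitzGamma Fq (n + 1) =
        carlitzD Fq i * carlitzGamma Fq (n - Fintype.card Fq ^ i + 1) * c := by
      intro i
      by_cases hi : Fintype.card Fq ^ i ≤ n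
      · obtain ⟨c, hc⟩ := carlitzD_mul_carlitzGamma_dvd Fq i (n - Fintype.card Fq ^ i)
        rw [Nat.sub_add_cancel hi] at hc
        exact ⟨c, fun _ => hc⟩
      · exact ⟨0, fun h => absurd h hi⟩
    choose c hc using hdvd
    have hlt : ∀ i, n - Fintype.card Fq ^ i < n := fun i =>
      Nat.sub_lt hn (pow_pos Fintype.card_pos i)
    -- `H_n = ∑ c_i(t) G_i H_(n-q^i)`. The cofactor is taken in the variable `t`: there it
    -- specialises to `c_i(θ)` for every `d` and does not raise the degree in `θ`. The range is
    -- large enough because `i < q^i ≤ n`.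
    refine ⟨∑ i ∈ (Finset.range n).filter fun i => Fintype.card Fq ^ i ≤ n,
      (c i).map Polynomial.C * (thakurG Fq i * H (n - Fintype.card Fq ^ i)),
      InnerDegreeLE.sum hq fun i hi => ?_, fun d => ?_⟩
    · have hi : Fintype.card Fq ^ i ≤ n := (Finset.mem_filter.mp hi).2
      refine ((innerDegreeLE_map_C _ _).mul hq ((innerDegreeLE_thakurG Fq i).mul hq
        (hH1 _ (hlt i)))).mono ?_
      rw [zero_add, ← mul_add, Nat.add_sub_cancel' hi]
    · rw [powerSum_recursion, if_neg hn.ne', zero_add, ← Finset.sum_filter, map_sum, map_sum,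
        Finset.mul_sum]
      have h1 : ∀ i, Fintype.card Fq ^ i ≤ n → i ≤ d →
          algebraMap Fq[X] (RatFunc Fq) (twistEval Fq d ((c i).map Polynomial.C *
            (thakurG Fq i * H (n - Fintype.card Fq ^ i)))) =
          algebraMap Fq[X] (RatFunc Fq) (carlitzGamma Fq (n + 1)) *
            (carlitzTerm Fq d i (ratL Fq d) * (ratL Fq d ^ (n - Fintype.card Fq ^ i + 1) *
              powerSum Fq d (n - Fintype.card Fq ^ i + 1))) := by
        intro i hi hid
        rw [map_mul, map_mul, twistEval_map_C, map_mul, map_mul, twistEval_thakurG_of_le Fq hid,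
          hH2 _ (hlt i), hc i hi, map_mul, map_mul]
        ring
      have h2 : ∀ i ∈ (Finset.range (d + 1)).filter (fun i => Fintype.card Fq ^ i ≤ n),
          i ∈ Finset.range n := fun i hi =>
        Finset.mem_range.mpr ((lt_card_pow_self Fq i).trans_le (Finset.mem_filter.mp hi).2)
      symm
      -- The recursion runs over `i ≤ d`, the definition of `H_n` over all `i` with `q^i ≤ n`; the
      -- additional terms have `d < i`, so `G_i` specialises to zero.
      refine Finset.sum_subset_zero_on_sdiff (fun i hi => Finset.mem_filter.mpr
        ⟨h2 i hi, (Finset.mem_filter.mp hi).2⟩) ?_ ?_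
      · intro i hi
        rw [Finset.mem_sdiff, Finset.mem_filter, Finset.mem_filter, Finset.mem_range,
          Finset.mem_range] at hi
        have : d < i := by
          by_contra hd
          exact hi.2 ⟨by omega, hi.1.2⟩
        rw [map_mul, map_mul (twistEval Fq d) (thakurG Fq i), twistEval_thakurG_of_lt Fq this]
        simp
      · intro i hi
        rw [Finset.mem_filter, Finset.mem_range] at hi
        exact (h1 i hi.2 (by omega)).symm

end AndersonThakur

/-! ### Twists, Cauchy estimates and evaluation of power series -/

section Convergence

theorem coeff_mul_mul_pow {R : Type*} [CommRing R] {f g : PowerSeries R} {x : R} (n : ℕ) :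
    PowerSeries.coeff n (f * g) * x ^ n =
      ∑ kl ∈ Finset.HasAntidiagonal.antidiagonal n, (PowerSeries.coeff kl.1 f * x ^ kl.1) *
        (PowerSeries.coeff kl.2 g * x ^ kl.2) := by
    rw [PowerSeries.coeff_mul, Finset.sum_mul]
    refine Finset.sum_congr rfl fun kl hkl => ?_
    rw [← Finset.HasAntidiagonal.mem_antidiagonal.mp hkl, pow_add]
    ring

theorem hasSum_antidiagonal_of_nonarchimedean {R : Type*} [CommRing R] [UniformSpace R]
    [IsUniformAddGroup R] [NonarchimedeanRing R] [T3Space R] {f g : ℕ → R} {a b : R}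
    (hf : HasSum f a) (hg : HasSum g b) :
    HasSum (fun n => ∑ kl ∈ Finset.HasAntidiagonal.antidiagonal n, f kl.1 * g kl.2) (a * b) := by
  have h : Summable (fun i : ℕ × ℕ ↦ f i.1 * g i.2) := hf.summable.mul_of_nonarchimedean hg.summable
  have h2 := (summable_sum_mul_antidiagonal_of_summable_mul h).hasSum
  have h3 := Summable.tsum_mul_tsum_eq_tsum_sum_antidiagonal hf.summable hg.summable h
  rw [hf.tsum_eq, hg.tsum_eq] at h3
  rw [h3]
  exact h2

variable {Fq : Type*} [Field Fq] [Fintype Fq]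

instance : NonarchimedeanRing (CInf Fq) where
  is_nonarchimedean := NonarchimedeanAddGroup.is_nonarchimedean

theorem frob_pow_apply (d : ℕ) (x : CInf Fq) :
    (frob Fq ^ (d : ℤ) : RingAut (CInf Fq)) x = x ^ Fintype.card Fq ^ d := by
  rw [zpow_natCast]
  induction d with
  | zero => simp
  | succ d ih => rw [pow_succ', RingAut.mul_apply, ih, frob_apply, ← pow_mul, ← pow_succ]

theorem coeff_twist (d n : ℕ) (f : PowerSeries (CInf Fq)) :
    PowerSeries.coeff n (twist (d : ℤ) f) = PowerSeries.coeff n f ^ Fintype.card Fq ^ d := by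
  rw [twist, PowerSeries.coeff_map]
  exact frob_pow_apply d _

theorem twist_C (d : ℕ) (x : CInf Fq) :
    twist (d : ℤ) (PowerSeries.C x) = PowerSeries.C (x ^ Fintype.card Fq ^ d) := by
  rw [twist, PowerSeries.map_C]
  exact congrArg _ (frob_pow_apply d x)

theorem twist_X (d : ℤ) : twist d (PowerSeries.X : PowerSeries (CInf Fq)) = PowerSeries.X := by
  rw [twist, PowerSeries.map_X]

theorem twist_twist (a b : ℤ) (f : PowerSeries (CInf Fq)) :
    twist a (twist b f) = twist (a + b) f := by
  ext n
  simp only [twist, PowerSeries.coeff_map, zpow_add]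
  rfl

theorem twist_zero (f : PowerSeries (CInf Fq)) : twist 0 f = f := by
  ext n
  simp only [twist, PowerSeries.coeff_map, zpow_zero]
  rfl

theorem norm_le_one_algebraMap (c : Fq) : ‖algebraMap Fq (CInf Fq) c‖ ≤ 1 := by
  by_cases hc : c = 0
  · simp [hc]
  · have h := congrArg (algebraMap Fq (CInf Fq)) (FiniteField.pow_card_sub_one_eq_one c hc)
    rw [map_pow, map_one] at h
    refine (pow_le_one_iff_of_nonneg (norm_nonneg _) (n := Fintype.card Fq - 1) ?_).mp ?_
    · exact (Nat.sub_pos_of_lt Fintype.one_lt_card).ne'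
    · rw [← norm_pow, h, norm_one]

/-- Cauchy's estimate `|a_n| ρ^n ≤ B` for the coefficients of a power series. -/
def CoeffBound (ρ B : ℝ) (f : PowerSeries (CInf Fq)) : Prop :=
  ∀ n, ‖PowerSeries.coeff n f‖ * ρ ^ n ≤ B

variable {ρ B B' : ℝ} {f g : PowerSeries (CInf Fq)}

theorem CoeffBound.nonneg (hf : CoeffBound ρ B f) : 0 ≤ B :=
  le_trans (by simp) (hf 0)

theorem CoeffBound.mono (hf : CoeffBound ρ B f) (h : B ≤ B') : CoeffBound ρ B' f :=
  fun n => (hf n).trans h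

/-- By the ultrametric inequality a coefficient of the product is bounded by its largest summand, as
for Gauss norms. -/
theorem CoeffBound.mul (hρ : 0 < ρ) (hf : CoeffBound ρ B f) (hg : CoeffBound ρ B' g) :
    CoeffBound ρ (B * B') (f * g) := by
  intro n
  have hB := mul_nonneg hf.nonneg hg.nonneg
  rw [← le_div_iff₀ (pow_pos hρ n), PowerSeries.coeff_mul]
  refine IsUltrametricDist.norm_sum_le_of_forall_le_of_nonneg (by positivity) fun x hx => ?_
  rw [le_div_iff₀ (pow_pos hρ n), ← Finset.HasAntidiagonal.mem_antidiagonal.mp hx, norm_mul,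
    pow_add]
  calc _ = (‖PowerSeries.coeff x.1 f‖ * ρ ^ x.1) * (‖PowerSeries.coeff x.2 g‖ * ρ ^ x.2) := by ring
    _ ≤ B * B' := mul_le_mul (hf _) (hg _) (by positivity) hf.nonneg

theorem coeffBound_C (ρ : ℝ) (x : CInf Fq) : CoeffBound ρ ‖x‖ (PowerSeries.C x) := by
  intro n
  rw [PowerSeries.coeff_C]
  split_ifs with h
  · simp [h]
  · simp

theorem CoeffBound.prod {ι : Type*} (hρ : 0 < ρ) (s : Finset ι) {f : ι → PowerSeries (CInf Fq)}
    {b : ι → ℝ} (h : ∀ i ∈ s, CoeffBound ρ (b i) (f i)) :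
    CoeffBound ρ (∏ i ∈ s, b i) (∏ i ∈ s, f i) := by
  classical
  induction s using Finset.induction_on with
  | empty => simpa using coeffBound_C ρ (1 : CInf Fq)
  | insert i s hi ih =>
    rw [Finset.prod_insert hi, Finset.prod_insert hi]
    exact (h i (Finset.mem_insert_self _ _)).mul hρ
      (ih fun j hj => h j (Finset.mem_insert_of_mem hj))

theorem CoeffBound.pow (hρ : 0 < ρ) (hf : CoeffBound ρ B f) (n : ℕ) :
    CoeffBound ρ (B ^ n) (f ^ n) := by
  simpa using CoeffBound.prod hρ (Finset.range n) fun _ _ => hf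

/-- The twist raises coefficients but not `t` to the power `q^d`. For `ρ ≥ 1` one has `ρ^n ≤
(ρ^n)^(q^d)`, so the same radius still serves. -/
theorem CoeffBound.twist (hρ : 1 ≤ ρ) (hf : CoeffBound ρ B f) (d : ℕ) :
    CoeffBound ρ (B ^ Fintype.card Fq ^ d) (twist (d : ℤ) f) := by
  intro n
  rw [coeff_twist, norm_pow]
  calc _ ≤ ‖PowerSeries.coeff n f‖ ^ Fintype.card Fq ^ d * (ρ ^ n) ^ Fintype.card Fq ^ d := by
        gcongr
        exact le_self_pow₀ (one_le_pow₀ hρ) (pow_pos Fintype.card_pos d).ne'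
    _ = (‖PowerSeries.coeff n f‖ * ρ ^ n) ^ Fintype.card Fq ^ d := (mul_pow _ _ _).symm
    _ ≤ _ := pow_le_pow_left₀ (by positivity) (hf n) _

theorem CoeffBound.norm_coeff_mul_pow_le (hρ : 0 < ρ) (hf : CoeffBound ρ B f) (x : CInf Fq)
    (n : ℕ) : ‖PowerSeries.coeff n f * x ^ n‖ ≤ B * (‖x‖ / ρ) ^ n := by
  rw [norm_mul, norm_pow, div_pow, ← mul_div_assoc, le_div_iff₀ (pow_pos hρ n)]
  calc _ = (‖PowerSeries.coeff n f‖ * ρ ^ n) * ‖x‖ ^ n := by ring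
    _ ≤ _ := by gcongr; exact hf n

theorem tendsto_pow_cofinite {r : ℝ} (h0 : 0 ≤ r) (h1 : r < 1) :
    Tendsto (fun n : ℕ => r ^ n) cofinite (𝓝 0) := by
  rw [Nat.cofinite_eq_atTop]
  exact tendsto_pow_atTop_nhds_zero_of_lt_one h0 h1

theorem CoeffBound.convergesAt (hf : CoeffBound ρ B f) {x : CInf Fq} (hx : ‖x‖ < ρ) :
    ConvergesAt f x := by
  have hρ : 0 < ρ := (norm_nonneg x).trans_lt hx
  refine NonarchimedeanAddGroup.summable_of_tendsto_cofinite_zero ?_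
  refine squeeze_zero_norm (hf.norm_coeff_mul_pow_le hρ x) ?_
  simpa using (tendsto_pow_cofinite (by positivity) ((div_lt_one hρ).mpr hx)).const_mul B

theorem CoeffBound.mem_tate (hρ : 1 < ρ) (hf : CoeffBound ρ B f) :
    f ∈ PowerSeries.IsRestricted.subring (R := CInf Fq) 1 := by
  rw [mem_tate_iff]
  have h := (hf.convergesAt (x := 1) (by simpa using hρ)).tendsto_atTop_zero.norm
  simpa using h

theorem convergesAt_mul_hasSum {x : CInf Fq} (hf : ConvergesAt f x) (hg : ConvergesAt g x) :
    HasSum (fun n => PowerSeries.coeff n (f * g) * x ^ n) (evalAt f x * evalAt g x) := by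
  refine (hasSum_antidiagonal_of_nonarchimedean (Summable.hasSum hf)
    (Summable.hasSum hg)).congr_fun fun n => ?_
  exact coeff_mul_mul_pow n

theorem ConvergesAt.mul {x : CInf Fq} (hf : ConvergesAt f x) (hg : ConvergesAt g x) :
    ConvergesAt (f * g) x := by
  unfold ConvergesAt
  exact (convergesAt_mul_hasSum hf hg).summable

theorem evalAt_mul {x : CInf Fq} (hf : ConvergesAt f x) (hg : ConvergesAt g x) :
    evalAt (f * g) x = evalAt f x * evalAt g x := by
  rw [evalAt]
  exact (convergesAt_mul_hasSum hf hg).tsum_eq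

theorem hasSum_coe_polynomial (P : (CInf Fq)[X]) (x : CInf Fq) :
    HasSum (fun n => PowerSeries.coeff n (P : PowerSeries (CInf Fq)) * x ^ n) (P.eval x) := by
  rw [Polynomial.eval_eq_sum_range]
  simp only [Polynomial.coeff_coe]
  refine hasSum_sum_of_ne_finset_zero fun n hn => ?_
  rw [Finset.mem_range, not_lt] at hn
  rw [Polynomial.coeff_eq_zero_of_natDegree_lt (by omega), zero_mul]

theorem convergesAt_C (c x : CInf Fq) : ConvergesAt (PowerSeries.C c) x := by
  simpa [ConvergesAt] using (hasSum_coe_polynomial (Polynomial.C c) x).summable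

theorem evalAt_C (c x : CInf Fq) : evalAt (PowerSeries.C c) x = c := by
  simpa [evalAt] using (hasSum_coe_polynomial (Polynomial.C c) x).tsum_eq

theorem convergesAt_prod_and_evalAt_prod {ι : Type*} (s : Finset ι)
    {f : ι → PowerSeries (CInf Fq)} {x : CInf Fq} (h : ∀ i ∈ s, ConvergesAt (f i) x) :
    ConvergesAt (∏ i ∈ s, f i) x ∧ evalAt (∏ i ∈ s, f i) x = ∏ i ∈ s, evalAt (f i) x := by
  classical
  induction s using Finset.induction_on with
  | empty =>
    simpa using And.intro (convergesAt_C (1 : CInf Fq) x) (evalAt_C (1 : CInf Fq) x)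
  | insert i s hi ih =>
    obtain ⟨h1, h2⟩ := ih fun j hj => h j (Finset.mem_insert_of_mem hj)
    have h3 := h i (Finset.mem_insert_self _ _)
    rw [Finset.prod_insert hi, Finset.prod_insert hi]
    exact ⟨h3.mul h1, by rw [evalAt_mul h3 h1, h2]⟩

theorem evalAt_prod {ι : Type*} (s : Finset ι)
    {f : ι → PowerSeries (CInf Fq)} {x : CInf Fq} (h : ∀ i ∈ s, ConvergesAt (f i) x) :
    evalAt (∏ i ∈ s, f i) x = ∏ i ∈ s, evalAt (f i) x :=
  (convergesAt_prod_and_evalAt_prod s h).2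

theorem ConvergesAt.pow {x : CInf Fq} (hf : ConvergesAt f x) (n : ℕ) : ConvergesAt (f ^ n) x := by
  simpa using (convergesAt_prod_and_evalAt_prod (Finset.range n) fun _ _ => hf).1

theorem evalAt_pow {x : CInf Fq} (hf : ConvergesAt f x) (n : ℕ) :
    evalAt (f ^ n) x = evalAt f x ^ n := by
  simpa using evalAt_prod (Finset.range n) fun _ _ => hf

/-- Coefficientwise sums of power series whose Cauchy estimates tend to zero. -/
theorem summable_coeff_of_coeffBound {D : Type*} (hρ : 0 < ρ) {T : D → PowerSeries (CInf Fq)}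
    {b : D → ℝ} (hT : ∀ d, CoeffBound ρ (b d) (T d)) (hb : Tendsto b cofinite (𝓝 0)) (n : ℕ) :
    Summable fun d => PowerSeries.coeff n (T d) := by
  refine NonarchimedeanAddGroup.summable_of_tendsto_cofinite_zero ?_
  refine squeeze_zero_norm (a := fun d => b d / ρ ^ n)
    (fun d => (le_div_iff₀ (pow_pos hρ n)).mpr (hT d n)) ?_
  simpa using hb.div_const (ρ ^ n)

/-- Evaluation commutes with coefficientwise sums. -/
theorem evalAt_mk_tsum {D : Type*} {T : D → PowerSeries (CInf Fq)}
    {b : D → ℝ} (hT : ∀ d, CoeffBound ρ (b d) (T d)) (hb : Tendsto b cofinite (𝓝 0))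
    {x : CInf Fq} (hx : ‖x‖ < ρ) :
    evalAt (PowerSeries.mk fun n => ∑' d, PowerSeries.coeff n (T d)) x = ∑' d, evalAt (T d) x := by
  have hρ : 0 < ρ := (norm_nonneg x).trans_lt hx
  -- The double family is bounded by a product of two null families, hence summable over pairs; this
  -- permits exchanging the two sums.
  have hs : Summable (Function.uncurry fun (d : D) (n : ℕ) =>
      PowerSeries.coeff n (T d) * x ^ n) := by
    refine NonarchimedeanAddGroup.summable_of_tendsto_cofinite_zero ?_
    refine squeeze_zero_norm (fun p => (hT p.1).norm_coeff_mul_pow_le hρ x p.2) ?_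
    exact tendsto_mul_cofinite_nhds_zero hb
      (tendsto_pow_cofinite (by positivity) ((div_lt_one hρ).mpr hx))
  simp only [evalAt]
  rw [← hs.tsum_comm]
  refine tsum_congr fun n => ?_
  rw [PowerSeries.coeff_mk, tsum_mul_right]

end Convergence

/-! ### The function `Ω`: convergence, nonvanishing at `θ`, functional equation -/

section Omega

variable {Fq : Type*} [Field Fq] [Fintype Fq]

variable (Fq) in
/-- The radius of the largest open disc around `0` on which `Ω` has no zero. -/
def rho : ℝ := (Fintype.card Fq : ℝ) ^ Fintype.card Fq

variable (Fq) in
theorem one_lt_card_real : (1 : ℝ) < Fintype.card Fq := by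
  exact_mod_cast Fintype.one_lt_card

variable (Fq) in
theorem norm_theta_lt_rho : ‖theta Fq‖ < rho Fq := by
  rw [norm_theta, rho]
  exact lt_self_pow₀ (one_lt_card_real Fq) Fintype.one_lt_card

variable (Fq) in
theorem one_lt_rho : 1 < rho Fq :=
  one_lt_pow₀ (one_lt_card_real Fq) Fintype.card_ne_zero

variable (Fq) in
theorem rho_pos : 0 < rho Fq := one_pos.trans (one_lt_rho Fq)

variable (Fq) in
theorem theta_ne_zero : theta Fq ≠ 0 := by
  rw [← norm_ne_zero_iff, norm_theta]
  exact (one_pos.trans (one_lt_card_real Fq)).ne'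

variable {lam : CInf Fq} (hlam : lam ^ (Fintype.card Fq - 1) = -theta Fq)

include hlam in
theorem norm_lam_pow : ‖lam‖ ^ (Fintype.card Fq - 1) = Fintype.card Fq := by
  rw [← norm_pow, hlam, norm_neg, norm_theta]

include hlam in
theorem one_lt_norm_lam : 1 < ‖lam‖ := by
  by_contra! h
  have h1 := pow_le_one₀ (norm_nonneg lam) h (n := Fintype.card Fq - 1)
  rw [norm_lam_pow hlam] at h1
  exact (one_lt_card_real Fq).not_ge h1

include hlam in
theorem lam_ne_zero : lam ≠ 0 :=
  norm_ne_zero_iff.mp (one_pos.trans (one_lt_norm_lam hlam)).ne'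

variable (lam)

/-- Every factor has bound `1` because `|θ|^(q^(i+1)) ≥ q^q`. The bound is thus uniform in `N` and
passes to the limit. -/
theorem coeffBound_omegaPartial (N : ℕ) :
    CoeffBound (rho Fq) ((‖lam‖ ^ Fintype.card Fq)⁻¹) (omegaPartial lam N) := by
  have hf : ∀ i ∈ Finset.range N, CoeffBound (rho Fq) 1
      (1 - PowerSeries.C ((theta Fq ^ Fintype.card Fq ^ (i + 1))⁻¹) * PowerSeries.X) := by
    intro i _ n
    rw [map_sub, PowerSeries.coeff_one]
    rcases n with _ | _ | n
    · simp
    · rw [zero_add, ← zero_add 1, PowerSeries.coeff_succ_mul_X, PowerSeries.coeff_C, if_pos rfl,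
        if_neg (by omega), zero_sub, norm_neg, norm_inv, norm_pow, norm_theta, zero_add, pow_one,
        inv_mul_le_one₀ (by have := one_lt_card_real Fq; positivity), rho]
      exact pow_le_pow_right₀ (one_lt_card_real Fq).le
        (Nat.le_self_pow (Nat.succ_ne_zero i) _)
    · rw [PowerSeries.coeff_succ_mul_X, PowerSeries.coeff_C, if_neg (by omega),
        if_neg (by omega)]
      simp
  have h := (coeffBound_C (rho Fq) ((lam ^ Fintype.card Fq)⁻¹)).mul (rho_pos Fq)
    (CoeffBound.prod (rho_pos Fq) (Finset.range N) hf)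
  rwa [Finset.prod_const_one, mul_one, norm_inv, norm_pow] at h

theorem tendsto_coeff_omegaPartial (n : ℕ) :
    Tendsto (fun N => PowerSeries.coeff n (omegaPartial lam N)) atTop
      (𝓝 (PowerSeries.coeff n (omega lam))) := by
  rw [omega, PowerSeries.coeff_mk]
  refine tendsto_nhds_limUnder (cauchySeq_tendsto_of_complete
    (NonarchimedeanAddGroup.cauchySeq_of_tendsto_sub_nhds_zero ?_))
  have hdiff : ∀ N, omegaPartial lam (N + 1) - omegaPartial lam N =
      PowerSeries.C (-(theta Fq ^ Fintype.card Fq ^ (N + 1))⁻¹) *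
        (omegaPartial lam N * PowerSeries.X) := by
    intro N
    rw [omegaPartial, Finset.prod_range_succ, omegaPartial, map_neg]
    ring
  rcases n with _ | n
  · refine tendsto_const_nhds.congr fun N => ?_
    rw [← map_sub, hdiff]
    simp
  · have hB := fun N => coeffBound_omegaPartial lam N n
    -- The crude inequality `N ≤ q^(N+1)` replaces the true decay `q^(-q^(N+1))` by a geometric one;
    -- in the ultrametric setting null differences suffice.
    refine squeeze_zero_norm (a := fun N => ((Fintype.card Fq : ℝ)⁻¹) ^ N *
      ((‖lam‖ ^ Fintype.card Fq)⁻¹ / rho Fq ^ n)) (fun N => ?_) ?_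
    · rw [← map_sub, hdiff, PowerSeries.coeff_C_mul, PowerSeries.coeff_succ_mul_X, norm_mul,
        norm_neg, norm_inv, norm_pow, norm_theta, inv_pow]
      have h1 := one_lt_card_real Fq
      have h2 := rho_pos Fq
      refine mul_le_mul (inv_anti₀ (by positivity) (pow_le_pow_right₀ h1.le ?_))
        ((le_div_iff₀ (by positivity)).mpr (hB N)) (norm_nonneg _) (by positivity)
      exact ((Nat.lt_succ_self N).trans (lt_card_pow_self Fq _)).le
    · have := (tendsto_pow_atTop_nhds_zero_of_lt_one (inv_nonneg.mpr (Nat.cast_nonneg _))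
        (inv_lt_one_of_one_lt₀ (one_lt_card_real Fq))).mul_const
          ((‖lam‖ ^ Fintype.card Fq)⁻¹ / rho Fq ^ n)
      rwa [zero_mul] at this

theorem coeffBound_omega : CoeffBound (rho Fq) ((‖lam‖ ^ Fintype.card Fq)⁻¹) (omega lam) :=
  fun n => le_of_tendsto (((tendsto_coeff_omegaPartial lam n).norm).mul_const _)
    (Eventually.of_forall fun N => coeffBound_omegaPartial lam N n)

theorem convergesAt_omega : ConvergesAt (omega lam) (theta Fq) :=
  (coeffBound_omega lam).convergesAt (norm_theta_lt_rho Fq)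

theorem coeff_zero_omega : PowerSeries.coeff 0 (omega lam) = (lam ^ Fintype.card Fq)⁻¹ := by
  refine tendsto_nhds_unique (tendsto_coeff_omegaPartial lam 0)
    (tendsto_const_nhds.congr fun N => ?_)
  rw [omegaPartial, PowerSeries.coeff_zero_eq_constantCoeff, map_mul, map_prod]
  simp

variable {lam}

include hlam

theorem omega_ne_zero : omega lam ≠ 0 := by
  intro h
  have h1 := coeff_zero_omega lam
  rw [h, map_zero] at h1
  exact inv_ne_zero (pow_ne_zero _ (lam_ne_zero hlam)) h1.symm

/-- The constant term `λ^(-q)` dominates: all other terms at `θ` are at most `|λ|^(-q) |θ|/ρ`, which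
is strictly smaller. -/
theorem evalAt_omega_ne_zero : evalAt (omega lam) (theta Fq) ≠ 0 := by
  have hl := one_pos.trans (one_lt_norm_lam hlam)
  have h1 := one_lt_card_real Fq
  have hr := rho_pos Fq
  have hr1 : ‖theta Fq‖ / rho Fq < 1 := (div_lt_one hr).mpr (norm_theta_lt_rho Fq)
  intro h
  rw [evalAt, (convergesAt_omega lam).tsum_eq_zero_add, pow_zero, mul_one, coeff_zero_omega,
    add_eq_zero_iff_eq_neg] at h
  have h2 := congrArg norm h
  rw [norm_neg, norm_inv, norm_pow] at h2
  have h3 : ‖∑' n, PowerSeries.coeff (n + 1) (omega lam) * theta Fq ^ (n + 1)‖ ≤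
      (‖lam‖ ^ Fintype.card Fq)⁻¹ * (‖theta Fq‖ / rho Fq) := by
    refine IsUltrametricDist.norm_tsum_le_of_forall_le_of_nonneg (by positivity) fun n => ?_
    refine ((coeffBound_omega lam).norm_coeff_mul_pow_le hr (theta Fq) (n + 1)).trans ?_
    gcongr
    exact pow_le_of_le_one (by positivity) hr1.le (Nat.succ_ne_zero n)
  rw [← h2] at h3
  have h4 : (0 : ℝ) < (‖lam‖ ^ Fintype.card Fq)⁻¹ := by positivity
  nlinarith

/-- The twist shifts the factors by one; the missing first factor `1 - t/θ^q` is `t - θ^q` up to a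
constant, which the choice of `λ` makes correct. -/
theorem omegaPartial_succ (N : ℕ) : omegaPartial lam (N + 1) =
    (PowerSeries.X - PowerSeries.C (theta Fq ^ Fintype.card Fq)) *
      twist (1 : ℕ) (omegaPartial lam N) := by
  have hl := lam_ne_zero hlam
  have ht := theta_ne_zero Fq
  -- This is `λ^(q^2) = (-θ)^q λ^q = -θ^q λ^q`.
  have hC : ((lam ^ Fintype.card Fq)⁻¹) ^ Fintype.card Fq * theta Fq ^ Fintype.card Fq =
      -(lam ^ Fintype.card Fq)⁻¹ := by
    have h1 : (lam ^ Fintype.card Fq) ^ Fintype.card Fq =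
        (-theta Fq) ^ Fintype.card Fq * lam ^ Fintype.card Fq := by
      rw [← hlam, ← mul_pow, ← pow_succ, Nat.sub_add_cancel Fintype.card_pos]
    have h2 : (-theta Fq) ^ Fintype.card Fq = -theta Fq ^ Fintype.card Fq :=
      map_neg (FiniteField.frobeniusAlgHom Fq (CInf Fq)) (theta Fq)
    rw [inv_pow, h1, h2]
    field_simp
  have hfac : ∀ i, twist (1 : ℕ) (1 - PowerSeries.C ((theta Fq ^ Fintype.card Fq ^ (i + 1))⁻¹) *
      PowerSeries.X) = 1 - PowerSeries.C ((theta Fq ^ Fintype.card Fq ^ (i + 1 + 1))⁻¹) *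
      PowerSeries.X := by
    intro i
    rw [map_sub, map_one, map_mul, twist_C, twist_X, inv_pow, ← pow_mul, pow_one, ← pow_succ]
  rw [omegaPartial, omegaPartial, map_mul, map_prod, twist_C, pow_one, Finset.prod_range_succ']
  simp only [hfac]
  have h0 : PowerSeries.C ((lam ^ Fintype.card Fq)⁻¹) *
      (1 - PowerSeries.C ((theta Fq ^ Fintype.card Fq ^ (0 + 1))⁻¹) * PowerSeries.X) =
      (PowerSeries.X - PowerSeries.C (theta Fq ^ Fintype.card Fq)) *
        PowerSeries.C (((lam ^ Fintype.card Fq)⁻¹) ^ Fintype.card Fq) := by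
    have h1 : ((lam ^ Fintype.card Fq)⁻¹) ^ Fintype.card Fq =
        -(lam ^ Fintype.card Fq)⁻¹ * (theta Fq ^ Fintype.card Fq)⁻¹ := by
      rw [← hC]
      field_simp
    rw [sub_mul, ← map_mul PowerSeries.C, mul_comm (theta Fq ^ Fintype.card Fq), hC, h1, zero_add,
      pow_one]
    simp only [map_mul, map_neg]
    ring
  rw [mul_comm (∏ _ ∈ _, _), ← mul_assoc, h0, mul_assoc]

theorem omega_eq : omega lam =
    (PowerSeries.X - PowerSeries.C (theta Fq ^ Fintype.card Fq)) * twist (1 : ℕ) (omega lam) := by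
  have hcoeff : ∀ (f : PowerSeries (CInf Fq)) (n : ℕ), PowerSeries.coeff n
      ((PowerSeries.X - PowerSeries.C (theta Fq ^ Fintype.card Fq)) * twist (1 : ℕ) f) =
      (if n = 0 then 0 else PowerSeries.coeff (n - 1) f ^ Fintype.card Fq) -
        theta Fq ^ Fintype.card Fq * PowerSeries.coeff n f ^ Fintype.card Fq := by
    intro f n
    rw [sub_mul, map_sub, PowerSeries.coeff_C_mul, coeff_twist, pow_one]
    rcases n with _ | n
    · simp
    · rw [PowerSeries.coeff_succ_X_mul, coeff_twist, pow_one]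
      simp
  ext n
  refine tendsto_nhds_unique ((tendsto_coeff_omegaPartial lam n).comp (tendsto_add_atTop_nat 1)) ?_
  simp only [Function.comp_def, omegaPartial_succ hlam, hcoeff]
  refine Tendsto.sub ?_ (((tendsto_coeff_omegaPartial lam n).pow _).const_mul _)
  split_ifs
  · exact tendsto_const_nhds
  · exact (tendsto_coeff_omegaPartial lam _).pow _

theorem twist_neg_one_omega : twist (-1) (omega lam) =
    (PowerSeries.X - PowerSeries.C (theta Fq)) * omega lam := by
  have h : omega lam = twist (1 : ℕ)
      ((PowerSeries.X - PowerSeries.C (theta Fq)) * omega lam) := by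
    rw [map_mul, map_sub, twist_X, twist_C, pow_one]
    exact omega_eq hlam
  conv_lhs => rw [h, twist_twist]
  exact twist_zero _

/-- Iterating the functional equation. At `t = θ` the product becomes `ℓ_d`. -/
theorem omega_eq_prod_mul_twist (d : ℕ) : omega lam =
    (∏ j ∈ Finset.range d, (PowerSeries.X - PowerSeries.C (theta Fq ^ Fintype.card Fq ^ (j + 1)))) *
      twist (d : ℤ) (omega lam) := by
  induction d with
  | zero => simp [twist_zero]
  | succ d ih =>
    conv_lhs => rw [ih, omega_eq hlam]
    rw [Finset.prod_range_succ, map_mul, map_sub, twist_X, twist_C, twist_twist, ← pow_mul,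
      ← pow_succ', mul_assoc]
    norm_cast

end Omega

/-! ### Anderson–Thakur polynomials as power series: characterisation and estimate -/

section AndersonThakurSeries

variable {Fq : Type*} [Field Fq] [Fintype Fq]

theorem expand_card_pow (d : ℕ) (p : Fq[X]) :
    Polynomial.expand Fq (Fintype.card Fq ^ d) p = p ^ Fintype.card Fq ^ d := by
  induction d with
  | zero => simp
  | succ d ih =>
    rw [pow_succ, mul_comm, Polynomial.expand_mul, ih, FiniteField.expand_card, ← pow_mul, mul_comm]

variable (Fq) in
theorem ofA_injective : Function.Injective (ofA Fq) :=
  (algebraMap (RatFunc Fq) (CInf Fq)).injective.comp (RatFunc.algebraMap_injective Fq)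

variable (Fq) in
theorem ofA_X : ofA Fq Polynomial.X = theta Fq := by
  simp [ofA, theta, RatFunc.algebraMap_X]

theorem ofA_C (c : Fq) : ofA Fq (Polynomial.C c) = algebraMap Fq (CInf Fq) c := by
  rw [ofA, RingHom.comp_apply, RatFunc.algebraMap_C]
  rfl

theorem norm_ofA_le (p : Fq[X]) : ‖ofA Fq p‖ ≤ (Fintype.card Fq : ℝ) ^ p.natDegree := by
  conv_lhs => rw [p.as_sum_range_C_mul_X_pow, map_sum]
  refine IsUltrametricDist.norm_sum_le_of_forall_le_of_nonneg (by positivity) fun i hi => ?_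
  rw [map_mul, map_pow, ofA_C, ofA_X, norm_mul, norm_pow, norm_theta, ← one_mul (_ ^ p.natDegree)]
  refine mul_le_mul (norm_le_one_algebraMap _) (pow_le_pow_right₀ (one_lt_card_real Fq).le
    (Nat.lt_succ_iff.mp (Finset.mem_range.mp hi))) (by positivity) zero_le_one

/-- On `A = F_q[θ]` the power `p ↦ p^(q^d)` is the substitution `θ ↦ θ^(q^d)`, so twisting and
evaluating at `t = θ` is the algebraic specialisation. -/
theorem hasSum_twist_toSeries (d : ℕ) (H : Fq[X][X]) :
    HasSum (fun n => PowerSeries.coeff n (twist (d : ℤ) (toSeries H)) * theta Fq ^ n)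
      (ofA Fq (twistEval Fq d H)) := by
  let φ : Fq[X] →+* CInf Fq :=
    ((frob Fq ^ (d : ℤ) : RingAut (CInf Fq)) : CInf Fq →+* CInf Fq).comp (ofA Fq)
  have h1 : twist (d : ℤ) (toSeries H) = (H.map φ : (CInf Fq)[X]) := by
    ext n
    rw [twist, PowerSeries.coeff_map, toSeries, Polynomial.coeff_coe, Polynomial.coeff_coe,
      Polynomial.coeff_map, Polynomial.coeff_map]
    rfl
  have h2 : Polynomial.eval₂RingHom φ (theta Fq) = (ofA Fq).comp (twistEval Fq d) := by
    apply Polynomial.ringHom_ext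
    · intro p
      rw [RingHom.comp_apply, twistEval_C, expand_card_pow, map_pow, Polynomial.coe_eval₂RingHom,
        Polynomial.eval₂_C]
      exact frob_pow_apply d _
    · rw [RingHom.comp_apply, twistEval_X, ofA_X, Polynomial.coe_eval₂RingHom, Polynomial.eval₂_X]
  have h3 := hasSum_coe_polynomial (H.map φ) (theta Fq)
  rw [Polynomial.eval_map, ← Polynomial.coe_eval₂RingHom, h2] at h3
  rw [h1]
  exact h3

theorem convergesAt_twist_toSeries (d : ℕ) (H : Fq[X][X]) :
    ConvergesAt (twist (d : ℤ) (toSeries H)) (theta Fq) :=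
  (hasSum_twist_toSeries d H).summable

theorem evalAt_twist_toSeries (d : ℕ) (H : Fq[X][X]) :
    evalAt (twist (d : ℤ) (toSeries H)) (theta Fq) = ofA Fq (twistEval Fq d H) :=
  (hasSum_twist_toSeries d H).tsum_eq

theorem convergesAt_twist_omega (lam : CInf Fq) (d : ℕ) :
    ConvergesAt (twist (d : ℤ) (omega lam)) (theta Fq) :=
  ((coeffBound_omega lam).twist (one_lt_rho Fq).le d).convergesAt (norm_theta_lt_rho Fq)

variable {lam : CInf Fq}

theorem convergesAt_twist_mul (lam : CInf Fq) (d s : ℕ) (H : Fq[X][X]) :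
    ConvergesAt (twist (d : ℤ) (toSeries H * omega lam ^ s)) (theta Fq) := by
  rw [map_mul, map_pow]
  exact (convergesAt_twist_toSeries d H).mul ((convergesAt_twist_omega lam d).pow s)

section

variable (hlam : lam ^ (Fintype.card Fq - 1) = -theta Fq)

include hlam

theorem piTilde_ne_zero : piTilde lam ≠ 0 := inv_ne_zero (evalAt_omega_ne_zero hlam)

theorem evalAt_twist_omega (d : ℕ) : evalAt (twist (d : ℤ) (omega lam)) (theta Fq) =
    (piTilde lam * ofA Fq (carlitzL Fq d))⁻¹ := by
  have hP : (∏ j ∈ Finset.range d, ((PowerSeries.X : PowerSeries (CInf Fq)) -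
      PowerSeries.C (theta Fq ^ Fintype.card Fq ^ (j + 1)))) =
      ((∏ j ∈ Finset.range d, (Polynomial.X -
        Polynomial.C (theta Fq ^ Fintype.card Fq ^ (j + 1))) : (CInf Fq)[X]) :
          PowerSeries (CInf Fq)) := by
    rw [← Polynomial.coeToPowerSeries.ringHom_apply, map_prod]
    simp
  have hP' := hasSum_coe_polynomial (∏ j ∈ Finset.range d, (Polynomial.X -
        Polynomial.C (theta Fq ^ Fintype.card Fq ^ (j + 1))) : (CInf Fq)[X]) (theta Fq)
  rw [← hP] at hP'
  have h := evalAt_mul hP'.summable (convergesAt_twist_omega lam d)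
  rw [← omega_eq_prod_mul_twist hlam d, evalAt.eq_def (∏ j ∈ Finset.range d, _), hP'.tsum_eq] at h
  have hL : Polynomial.eval (theta Fq) (∏ j ∈ Finset.range d, (Polynomial.X -
        Polynomial.C (theta Fq ^ Fintype.card Fq ^ (j + 1))) : (CInf Fq)[X]) =
      ofA Fq (carlitzL Fq d) := by
    rw [Polynomial.eval_prod, carlitzL, map_prod]
    simp [ofA_X]
  have hL0 : ofA Fq (carlitzL Fq d) ≠ 0 := fun h0 =>
    carlitzL_ne_zero Fq d (ofA_injective Fq (h0.trans (map_zero _).symm))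
  rw [hL] at h
  rw [piTilde, h]
  field_simp

/-- Both sides of the analytic property carry `π̃^(-s)`, from `Ω^(d)(θ) = 1/(π̃ ℓ_d)`; it cancels
and an identity in `k` remains. -/
theorem isAndersonThakur_iff (s : ℕ) (H : Fq[X][X]) : IsAndersonThakur lam s H ↔
    ∀ d, algebraMap Fq[X] (RatFunc Fq) (twistEval Fq d H) =
      algebraMap Fq[X] (RatFunc Fq) (carlitzGamma Fq s) *
        (ratL Fq d ^ s * powerSum Fq d s) := by
  refine forall_congr' fun d => ?_
  have hpi := piTilde_ne_zero hlam
  have hL0 : ofA Fq (carlitzL Fq d) ≠ 0 := fun h0 =>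
    carlitzL_ne_zero Fq d (ofA_injective Fq (h0.trans (map_zero _).symm))
  have hval : evalAt (twist (d : ℤ) (toSeries H * omega lam ^ s)) (theta Fq) =
      ofA Fq (twistEval Fq d H) / (piTilde lam ^ s * ofA Fq (carlitzL Fq d) ^ s) := by
    rw [map_mul, map_pow, evalAt_mul (convergesAt_twist_toSeries d H)
      ((convergesAt_twist_omega lam d).pow s), evalAt_pow (convergesAt_twist_omega lam d),
      evalAt_twist_toSeries, evalAt_twist_omega hlam, inv_pow, mul_pow, div_eq_mul_inv]
  have hiff : HasSum (fun n => PowerSeries.coeff n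
      (twist (d : ℤ) (toSeries H * omega lam ^ s)) * theta Fq ^ n)
      (ofA Fq (carlitzGamma Fq s) * algebraMap (RatFunc Fq) (CInf Fq) (powerSum Fq d s) /
        piTilde lam ^ s) ↔
      ofA Fq (twistEval Fq d H) / (piTilde lam ^ s * ofA Fq (carlitzL Fq d) ^ s) =
        ofA Fq (carlitzGamma Fq s) * algebraMap (RatFunc Fq) (CInf Fq) (powerSum Fq d s) /
        piTilde lam ^ s := by
    rw [← hval]
    exact (Summable.hasSum_iff (convergesAt_twist_mul lam d s H))
  rw [hiff, ← (algebraMap (RatFunc Fq) (CInf Fq)).injective.eq_iff]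
  have h1 : ∀ p : Fq[X], algebraMap (RatFunc Fq) (CInf Fq) (algebraMap Fq[X] (RatFunc Fq) p) =
      ofA Fq p := fun _ => rfl
  rw [map_mul, map_mul, map_pow, ratL, h1, h1, h1]
  field_simp

theorem existsUnique_andersonThakur {s : ℕ} (hs : 0 < s) :
    ∃! H : Fq[X][X], IsAndersonThakur lam s H := by
  obtain ⟨n, rfl⟩ : ∃ n, s = n + 1 := ⟨s - 1, by omega⟩
  obtain ⟨H, -, hH⟩ := exists_andersonThakur Fq n
  refine ⟨H, (isAndersonThakur_iff hlam _ _).mpr hH, fun H' hH' => ?_⟩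
  have hH' := (isAndersonThakur_iff hlam _ _).mp hH'
  rw [← sub_eq_zero]
  refine eq_zero_of_twistEval fun d => ?_
  rw [map_sub, sub_eq_zero]
  exact RatFunc.algebraMap_injective Fq ((hH' d).trans (hH d).symm)

theorem isAndersonThakur_andersonThakur {s : ℕ} (hs : 0 < s) :
    IsAndersonThakur lam s (andersonThakur lam s) :=
  Classical.epsilon_spec (existsUnique_andersonThakur hlam hs).exists

/-- The degree bound is known for the constructed polynomial; uniqueness transfers it to the chosen
one. -/
theorem innerDegreeLE_andersonThakur {s : ℕ} (hs : 0 < s) :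
    InnerDegreeLE (Fintype.card Fq - 1) (andersonThakur lam s) (Fintype.card Fq * (s - 1)) := by
  obtain ⟨n, rfl⟩ : ∃ n, s = n + 1 := ⟨s - 1, by omega⟩
  obtain ⟨H, hdeg, hH⟩ := exists_andersonThakur Fq n
  rw [(existsUnique_andersonThakur hlam hs).unique (isAndersonThakur_andersonThakur hlam hs)
    ((isAndersonThakur_iff hlam _ _).mpr hH)]
  exact hdeg

/-- Anderson and Thakur's estimate for the twists of `H_{s-1} Ω^s`. -/
theorem coeffBound_twist_andersonThakur {s : ℕ} (hs : 0 < s) (d : ℕ) :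
    CoeffBound (rho Fq) (rho Fq ^ (andersonThakur lam s).natDegree *
      ((‖lam‖ ^ Fintype.card Fq)⁻¹) ^ Fintype.card Fq ^ d)
      (twist (d : ℤ) (toSeries (andersonThakur lam s) * omega lam ^ s)) := by
  have hl := one_lt_norm_lam hlam
  have hr := one_lt_rho Fq
  -- By `q = |λ|^(q-1)` the degree bound says that the coefficients have size at most
  -- `|λ|^(q(s-1))`. The factor from the degree in `t` stays outside the power `q^d`, as twisting
  -- fixes `t`.
  have hH : CoeffBound (rho Fq) ((‖lam‖ ^ (Fintype.card Fq * (s - 1))) ^ Fintype.card Fq ^ d *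
      rho Fq ^ (andersonThakur lam s).natDegree)
      (twist (d : ℤ) (toSeries (andersonThakur lam s))) := by
    intro n
    rw [coeff_twist, toSeries, Polynomial.coeff_coe, Polynomial.coeff_map, norm_pow]
    by_cases hn : n ≤ (andersonThakur lam s).natDegree
    · have hb : ‖ofA Fq ((andersonThakur lam s).coeff n)‖ ≤
          ‖lam‖ ^ (Fintype.card Fq * (s - 1)) := by
        refine (norm_ofA_le _).trans ?_
        rw [← norm_lam_pow hlam, ← pow_mul]
        exact pow_le_pow_right₀ hl.le (innerDegreeLE_andersonThakur hlam hs n)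
      have h2 := pow_le_pow_right₀ hr.le hn
      have h3 := (one_pos.trans hr).le
      gcongr
    · rw [Polynomial.coeff_eq_zero_of_natDegree_lt (not_le.mp hn), map_zero, norm_zero,
        zero_pow (pow_pos Fintype.card_pos d).ne', zero_mul]
      have h3 := (one_pos.trans hr).le
      positivity
  rw [map_mul, map_pow]
  have h := hH.mul (rho_pos Fq) (((coeffBound_omega lam).twist hr.le d).pow (rho_pos Fq) s)
  refine h.mono (le_of_eq ?_)
  -- The decisive balance: `|λ|^(q(s-1))` from `H_{s-1}` against `|λ|^(-qs)` from `Ω^s` leaves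
  -- `|λ|^(-q)`, which is less than `1`.
  have hkey : ‖lam‖ ^ (Fintype.card Fq * (s - 1)) * ((‖lam‖ ^ Fintype.card Fq)⁻¹) ^ s =
      (‖lam‖ ^ Fintype.card Fq)⁻¹ := by
    obtain ⟨n, rfl⟩ : ∃ n, s = n + 1 := ⟨s - 1, by omega⟩
    have := one_pos.trans hl
    rw [Nat.add_sub_cancel, pow_mul, inv_pow, pow_succ]
    field_simp
  generalize ‖lam‖ ^ (Fintype.card Fq * (s - 1)) = a at *
  generalize (‖lam‖ ^ Fintype.card Fq)⁻¹ = b at *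
  conv_rhs => rw [← hkey]
  ring

end

end AndersonThakurSeries

/-! ### Products of null sequences -/

section TendstoProd

/-- If the product is at least `ε`, so is each factor, because the others are at most `1`; each
index then lies in one finite set. -/
theorem tendsto_prod_cofinite {ι : Type*} [Fintype ι] {b : ℕ → ℝ} (h0 : ∀ n, 0 ≤ b n)
    (h1 : ∀ n, b n ≤ 1) (hb : Tendsto b cofinite (𝓝 0)) :
    Tendsto (fun d : ι → ℕ => ∏ i, b (d i)) cofinite (𝓝 0) := by
  rw [Metric.tendsto_nhds]
  intro ε hε
  have hfin : {n | ε ≤ b n}.Finite := by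
    have := (tendsto_order.mp hb).2 ε hε
    rw [eventually_cofinite] at this
    simpa using this
  rw [eventually_cofinite]
  refine (Set.Finite.pi' fun _ : ι => hfin).subset ?_
  intro d hd i
  rw [Set.mem_ofPred_eq, dist_zero_right, not_lt, Real.norm_of_nonneg
    (Finset.prod_nonneg fun _ _ => h0 _)] at hd
  refine hd.trans ?_
  classical
  rw [← Finset.mul_prod_erase Finset.univ _ (Finset.mem_univ i)]
  exact mul_le_of_le_one_right (h0 _) (Finset.prod_le_one (fun _ _ => h0 _) fun _ _ => h1 _)

end TendstoProd

/-! ### The series `L(s; ε)`: convergence, value at `θ`, functional equation -/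

section LSeries

theorem prod_eq_mul_prod_comp {ι ι' M : Type*} [Fintype ι] [Fintype ι'] [CommMonoid M] {f : ι' → ι}
    (hf : Function.Injective f) {m : ι} (hm : ∀ x, x = m ∨ x ∈ Set.range f) (hmf : m ∉ Set.range f)
    (g : ι → M) : ∏ x, g x = g m * ∏ y, g (f y) := by
  classical
  have huniv : (Finset.univ : Finset ι) = insert m (Finset.univ.map ⟨f, hf⟩) := by
    ext x
    simpa using hm x
  rw [huniv, Finset.prod_insert (by simpa using hmf), Finset.prod_map]
  rfl

variable {Fq : Type*} [Field Fq] [Fintype Fq]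

variable {ι : Type*} [Fintype ι] {lam : CInf Fq}

theorem algebraMap_pow_card_pow (c : Fq) (n : ℕ) :
    algebraMap Fq (CInf Fq) c ^ Fintype.card Fq ^ n = algebraMap Fq (CInf Fq) c := by
  rw [← map_pow, FiniteField.pow_card_pow]

section

variable (hlam : lam ^ (Fintype.card Fq - 1) = -theta Fq) {s : ι → ℕ} (hs : ∀ i, 0 < s i)
  (ε : ι → Fqˣ)

include hlam hs

theorem coeffBound_lTerm (d : ι → ℕ) :
    CoeffBound (rho Fq) ((∏ i, rho Fq ^ (andersonThakur lam (s i)).natDegree) *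
      ∏ i, ((‖lam‖ ^ Fintype.card Fq)⁻¹) ^ Fintype.card Fq ^ d i) (lTerm lam s ε d) := by
  rw [← Finset.prod_mul_distrib]
  refine CoeffBound.prod (rho_pos Fq) _ fun i _ => ?_
  have hε : CoeffBound (rho Fq) 1
      (PowerSeries.C (algebraMap Fq (CInf Fq) (ε i : Fq) ^ d i)) := by
    refine (coeffBound_C _ _).mono ?_
    rw [norm_pow]
    exact pow_le_one₀ (norm_nonneg _) (norm_le_one_algebraMap _)
  simpa using hε.mul (rho_pos Fq) (coeffBound_twist_andersonThakur hlam (hs i) (d i))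

omit hs in
theorem inv_norm_lam_pow_card_lt_one : (‖lam‖ ^ Fintype.card Fq)⁻¹ < 1 :=
  inv_lt_one_of_one_lt₀ (one_lt_pow₀ (one_lt_norm_lam hlam) Fintype.card_ne_zero)

theorem coeffBound_lTerm' (d : ι → ℕ) :
    CoeffBound (rho Fq) (∏ i, rho Fq ^ (andersonThakur lam (s i)).natDegree)
      (lTerm lam s ε d) := by
  refine (coeffBound_lTerm hlam hs ε d).mono (mul_le_of_le_one_right ?_ ?_)
  · exact Finset.prod_nonneg fun _ _ => pow_nonneg (rho_pos Fq).le _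
  · exact Finset.prod_le_one (fun _ _ => by positivity) fun _ _ =>
      pow_le_one₀ (by positivity) (inv_norm_lam_pow_card_lt_one hlam).le

omit hs in
variable (ι) in
theorem tendsto_prod_inv_norm_lam :
    Tendsto (fun d : ι → ℕ => ∏ i, ((‖lam‖ ^ Fintype.card Fq)⁻¹) ^ Fintype.card Fq ^ d i)
      cofinite (𝓝 0) := by
  have h1 := inv_norm_lam_pow_card_lt_one hlam
  have h0 : 0 ≤ (‖lam‖ ^ Fintype.card Fq)⁻¹ := by positivity
  refine tendsto_prod_cofinite (b := fun n => ((‖lam‖ ^ Fintype.card Fq)⁻¹) ^ Fintype.card Fq ^ n)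
    (fun n => pow_nonneg h0 _) (fun n => pow_le_one₀ h0 h1.le) ?_
  exact (tendsto_pow_cofinite h0 h1).comp (card_pow_injective Fq).tendsto_cofinite

variable [LinearOrder ι]

omit hs in
variable (s) in
theorem tendsto_lTerm_bound :
    Tendsto (fun d : {d : ι → ℕ // StrictAnti d} =>
      (∏ i, rho Fq ^ (andersonThakur lam (s i)).natDegree) *
        ∏ i, ((‖lam‖ ^ Fintype.card Fq)⁻¹) ^ Fintype.card Fq ^ d.1 i) cofinite (𝓝 0) := by
  simpa using ((tendsto_prod_inv_norm_lam ι hlam).comp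
    Subtype.val_injective.tendsto_cofinite).const_mul _

theorem summable_coeff_lTerm (n : ℕ) : Summable fun d : {d : ι → ℕ // StrictAnti d} =>
    PowerSeries.coeff n (lTerm lam s ε d.1) :=
  summable_coeff_of_coeffBound (T := fun d : {d : ι → ℕ // StrictAnti d} => lTerm lam s ε d.1)
    (rho_pos Fq) (fun d => coeffBound_lTerm hlam hs ε d.1) (tendsto_lTerm_bound hlam s) n

open scoped PowerSeries.WithPiTopology in
theorem hasSum_lSeries : HasSum (fun d : {d : ι → ℕ // StrictAnti d} => lTerm lam s ε d.1)
    (lSeries lam s ε) := by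
  rw [PowerSeries.WithPiTopology.hasSum_iff_hasSum_coeff]
  intro n
  rw [lSeries, PowerSeries.coeff_mk]
  exact (summable_coeff_lTerm hlam hs ε n).hasSum

theorem coeffBound_lSeries :
    CoeffBound (rho Fq) (∏ i, rho Fq ^ (andersonThakur lam (s i)).natDegree)
      (lSeries lam s ε) := by
  intro n
  have hr := pow_pos (rho_pos Fq) n
  rw [lSeries, PowerSeries.coeff_mk, ← le_div_iff₀ hr]
  refine IsUltrametricDist.norm_tsum_le_of_forall_le_of_nonneg
    (div_nonneg (Finset.prod_nonneg fun _ _ => pow_nonneg (rho_pos Fq).le _) hr.le) fun d => ?_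
  rw [le_div_iff₀ hr]
  exact coeffBound_lTerm' hlam hs ε d.1 n

/-- The terms are evaluated separately; each twisted factor takes the value prescribed by the
Anderson–Thakur property. -/
theorem evalAt_lSeries : evalAt (lSeries lam s ε) (theta Fq) =
    ∑' d : {d : ι → ℕ // StrictAnti d}, ∏ i, (algebraMap Fq (CInf Fq) (ε i : Fq) ^ d.1 i *
      (ofA Fq (carlitzGamma Fq (s i)) *
        algebraMap (RatFunc Fq) (CInf Fq) (powerSum Fq (d.1 i) (s i)) / piTilde lam ^ s i)) := by
  rw [lSeries, evalAt_mk_tsum (T := fun d : {d : ι → ℕ // StrictAnti d} => lTerm lam s ε d.1)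
    (fun d => coeffBound_lTerm hlam hs ε d.1) (tendsto_lTerm_bound hlam s) (norm_theta_lt_rho Fq)]
  refine tsum_congr fun d => ?_
  rw [lTerm, evalAt_prod]
  · refine Finset.prod_congr rfl fun i _ => ?_
    rw [evalAt_mul (convergesAt_C _ _) (convergesAt_twist_mul lam _ _ _), evalAt_C]
    congr 1
    rw [evalAt]
    exact (isAndersonThakur_andersonThakur hlam (hs i) (d.1 i)).tsum_eq
  · exact fun i _ => (convergesAt_C _ _).mul (convergesAt_twist_mul lam _ _ _)

end

/-- The twist fixes the powers of `ε_i`, which lie in `F_q`, so raising each index by one costs a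
single factor `ε_i` apiece. -/
theorem lTerm_add_one (lam : CInf Fq) (s : ι → ℕ) (ε : ι → Fqˣ) (d : ι → ℕ) :
    lTerm lam s ε (fun i => d i + 1) =
      PowerSeries.C (∏ i, algebraMap Fq (CInf Fq) (ε i : Fq)) *
        twist (1 : ℕ) (lTerm lam s ε d) := by
  rw [lTerm, lTerm, map_prod, map_prod, ← Finset.prod_mul_distrib]
  refine Finset.prod_congr rfl fun i _ => ?_
  rw [map_mul (twist (1 : ℕ)), twist_C, twist_twist, pow_right_comm, algebraMap_pow_card_pow,
    pow_succ', map_mul PowerSeries.C, mul_assoc]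
  push_cast
  rw [add_comm (d i : ℤ)]

theorem hasSum_twist {D : Type*} (k : ℕ) {T : D → PowerSeries (CInf Fq)}
    {L : PowerSeries (CInf Fq)} (h : ∀ n, HasSum (fun d => PowerSeries.coeff n (T d))
      (PowerSeries.coeff n L)) (n : ℕ) :
    HasSum (fun d => PowerSeries.coeff n (twist (k : ℤ) (T d)))
      (PowerSeries.coeff n (twist (k : ℤ) L)) := by
  have hc : Continuous ((frob Fq ^ (k : ℤ) : RingAut (CInf Fq)) : CInf Fq →+* CInf Fq) := by
    have : (((frob Fq ^ (k : ℤ) : RingAut (CInf Fq)) : CInf Fq →+* CInf Fq) :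
        CInf Fq → CInf Fq) = fun x => x ^ Fintype.card Fq ^ k := funext (frob_pow_apply k)
    rw [this]
    exact continuous_pow _
  have := (h n).map ((frob Fq ^ (k : ℤ) : RingAut (CInf Fq)) : CInf Fq →+* CInf Fq) hc
  refine HasSum.congr_fun this fun d => ?_
  rw [twist, PowerSeries.coeff_map]
  rfl

/-- The extension by zero at the new greatest element of a shifted index of summation. -/
theorem lTerm_extend {ι' : Type*} [Fintype ι'] (lam : CInf Fq) (s : ι → ℕ) (ε : ι → Fqˣ)
    {f : ι' → ι} (hf : Function.Injective f) {m : ι} (hm : ∀ x, x = m ∨ x ∈ Set.range f)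
    (hmf : m ∉ Set.range f) (d : ι' → ℕ) :
    lTerm lam s ε (Function.extend f (fun y => d y + 1) fun _ => 0) =
      lTerm lam (s ∘ f) (ε ∘ f) (fun y => d y + 1) *
        (toSeries (andersonThakur lam (s m)) * omega lam ^ s m) := by
  rw [lTerm, prod_eq_mul_prod_comp hf hm hmf, mul_comm,
    Function.extend_apply' _ _ _ (by simpa using hmf), lTerm]
  congr 1
  · refine Finset.prod_congr rfl fun y _ => ?_
    rw [hf.extend_apply]
    rfl
  · simp [twist_zero]

variable [LinearOrder ι] {ι' : Type*} [Fintype ι'] [LinearOrder ι']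

theorem strictAnti_extend {ι ι' : Type*} [LinearOrder ι] [LinearOrder ι'] {f : ι' → ι}
    (hf : StrictMono f) {m : ι}
    (hm : ∀ x, x = m ∨ x ∈ Set.range f) (hmf : ∀ y, f y < m) {d : ι' → ℕ} (hd : StrictAnti d) :
    StrictAnti (Function.extend f (fun y => d y + 1) fun _ => 0) := by
  have hmr : ¬ ∃ y, f y = m := fun ⟨y, hy⟩ => (hmf y).ne hy
  intro x x' hxx'
  rcases hm x with rfl | ⟨y, rfl⟩
  · rcases hm x' with rfl | ⟨y', rfl⟩
    · exact absurd hxx' (lt_irrefl _)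
    · exact absurd hxx' (hmf y').not_gt
  · rw [hf.injective.extend_apply]
    rcases hm x' with rfl | ⟨y', rfl⟩
    · rw [Function.extend_apply' _ _ _ hmr]
      exact Nat.succ_pos _
    · rw [hf.injective.extend_apply]
      exact Nat.succ_lt_succ (hd (hf.lt_iff_lt.mp hxx'))

/-- A strictly decreasing function is either positive everywhere or zero at the greatest element
of its domain. -/
def strictAntiEquiv {ι ι' : Type*} [LinearOrder ι] [LinearOrder ι'] {f : ι' → ι}
    (hf : StrictMono f) {m : ι}
    (hm : ∀ x, x = m ∨ x ∈ Set.range f) (hmf : ∀ y, f y < m) :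
    {d : ι → ℕ // StrictAnti d} ⊕ {d : ι' → ℕ // StrictAnti d} ≃ {d : ι → ℕ // StrictAnti d} :=
  Equiv.ofBijective
    (Sum.elim (fun d => ⟨fun i => d.1 i + 1, fun _ _ h => Nat.succ_lt_succ (d.2 h)⟩)
      fun d => ⟨_, strictAnti_extend hf hm hmf d.2⟩) (by
    have hmr : ¬ ∃ y, f y = m := fun ⟨y, hy⟩ => (hmf y).ne hy
    constructor
    · rintro (a | a) (b | b) hab
      · have hab' := fun i => congrFun (congrArg Subtype.val hab) i
        refine congrArg Sum.inl (Subtype.ext (funext fun i => ?_))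
        simpa using hab' i
      -- The two kinds of images are told apart by their value at the greatest element: positive for
      -- shifts, zero for extensions.
      · have hab' := congrFun (congrArg Subtype.val hab) m
        simp [Function.extend_apply' _ _ _ hmr] at hab'
      · have hab' := congrFun (congrArg Subtype.val hab) m
        simp [Function.extend_apply' _ _ _ hmr] at hab'
      · have hab' := fun i => congrFun (congrArg Subtype.val hab) (f i)
        refine congrArg Sum.inr (Subtype.ext (funext fun i => ?_))
        simpa [hf.injective.extend_apply] using hab' i
    · intro d
      have hlast : ∀ y, d.1 m < d.1 (f y) := fun y => d.2 (hmf y)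
      by_cases h0 : d.1 m = 0
      · refine ⟨Sum.inr ⟨fun y => d.1 (f y) - 1, fun y y' h => ?_⟩,
          Subtype.ext (funext fun x => ?_)⟩
        · have h1 := d.2 (hf h)
          have h2 := hlast y'
          dsimp only
          omega
        · rcases hm x with rfl | ⟨y, rfl⟩
          · simp [Function.extend_apply' _ _ _ hmr, h0]
          · have h2 := hlast y
            simp only [Sum.elim_inr, hf.injective.extend_apply]
            omega
      · have hpos : ∀ x, 0 < d.1 x := by
          intro x
          rcases hm x with rfl | ⟨y, rfl⟩
          · omega
          · have h2 := hlast y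
            omega
        refine ⟨Sum.inl ⟨fun x => d.1 x - 1, fun x x' h => ?_⟩, Subtype.ext (funext fun x => ?_)⟩
        · have h1 := d.2 h
          have h2 := hpos x'
          dsimp only
          omega
        · exact Nat.sub_add_cancel (hpos x))

open scoped PowerSeries.WithPiTopology in
/-- The functional equation of `L(s; ε)`: splitting off the terms whose last index is zero. -/
theorem lSeries_eq (hlam : lam ^ (Fintype.card Fq - 1) = -theta Fq) {s : ι → ℕ} (hs : ∀ i, 0 < s i)
    (ε : ι → Fqˣ) {f : ι' → ι} (hf : StrictMono f) {m : ι}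
    (hm : ∀ x, x = m ∨ x ∈ Set.range f) (hmf : ∀ y, f y < m) :
    lSeries lam s ε =
      PowerSeries.C (∏ i, algebraMap Fq (CInf Fq) (ε i : Fq)) * twist (1 : ℕ) (lSeries lam s ε) +
      PowerSeries.C (∏ y, algebraMap Fq (CInf Fq) (ε (f y) : Fq)) *
        twist (1 : ℕ) (lSeries lam (s ∘ f) (ε ∘ f)) *
        (toSeries (andersonThakur lam (s m)) * omega lam ^ s m) := by
  have hmr : m ∉ Set.range f := fun ⟨y, hy⟩ => (hmf y).ne hy
  have h1 : HasSum (fun d : {d : ι → ℕ // StrictAnti d} => twist (1 : ℕ) (lTerm lam s ε d.1))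
      (twist (1 : ℕ) (lSeries lam s ε)) := by
    rw [PowerSeries.WithPiTopology.hasSum_iff_hasSum_coeff]
    exact hasSum_twist 1 ((PowerSeries.WithPiTopology.hasSum_iff_hasSum_coeff _).mp
      (hasSum_lSeries hlam hs ε))
  have h2 : HasSum (fun d : {d : ι' → ℕ // StrictAnti d} =>
      twist (1 : ℕ) (lTerm lam (s ∘ f) (ε ∘ f) d.1))
      (twist (1 : ℕ) (lSeries lam (s ∘ f) (ε ∘ f))) := by
    rw [PowerSeries.WithPiTopology.hasSum_iff_hasSum_coeff]
    exact hasSum_twist 1 ((PowerSeries.WithPiTopology.hasSum_iff_hasSum_coeff _).mp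
      (hasSum_lSeries hlam (fun y => hs (f y)) (ε ∘ f)))
  have h3 := hasSum_lSeries hlam hs ε
  -- Sequences with positive last index are shifts by one of arbitrary ones and give the twist of
  -- the whole series. Those with last index zero are shifted shorter sequences and give the twist
  -- of the shorter series times the untwisted `H Ω^s` at `m`.
  rw [← (strictAntiEquiv hf hm hmf).hasSum_iff] at h3
  refine h3.unique (HasSum.sum ?_ ?_)
  · refine (h1.mul_left _).congr_fun fun d => ?_
    exact lTerm_add_one lam s ε d.1
  · refine ((h2.mul_left _).mul_right _).congr_fun fun d => ?_
    refine (lTerm_extend lam s ε hf.injective hm hmr d.1).trans ?_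
    rw [lTerm_add_one]
    rfl

theorem lSeries_comp_orderIso (lam : CInf Fq) (s : ι → ℕ) (ε : ι → Fqˣ) (e : ι' ≃o ι) :
    lSeries lam (s ∘ e) (ε ∘ e) = lSeries lam s ε := by
  let E : {d : ι → ℕ // StrictAnti d} ≃ {d : ι' → ℕ // StrictAnti d} :=
    (e.symm.toEquiv.arrowCongr (Equiv.refl ℕ)).subtypeEquiv fun d =>
      ⟨fun h => h.comp_strictMono e.strictMono, fun h => by
        simpa [Function.comp_def] using h.comp_strictMono e.symm.strictMono⟩
  ext n
  rw [lSeries, lSeries, PowerSeries.coeff_mk, PowerSeries.coeff_mk, ← E.tsum_eq]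
  refine tsum_congr fun d => ?_
  congr 1
  exact Fintype.prod_equiv e.toEquiv _ _ fun _ => rfl

theorem lSeries_of_isEmpty [IsEmpty ι] (lam : CInf Fq) (s : ι → ℕ) (ε : ι → Fqˣ) :
    lSeries lam s ε = 1 := by
  have hu : Unique {d : ι → ℕ // StrictAnti d} :=
    { default := ⟨isEmptyElim, fun i => isEmptyElim i⟩
      uniq := fun _ => Subtype.ext (funext fun i => isEmptyElim i) }
  ext n
  rw [lSeries, PowerSeries.coeff_mk, tsum_fintype, Fintype.sum_unique]
  simp [lTerm]

end LSeries

/-! ### The multizeta series and its grouping by degrees -/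

section Zeta

variable {Fq : Type*} [Field Fq] [Fintype Fq] {r : ℕ}

theorem norm_ofA_of_monic {a : Fq[X]} (ha : a.Monic) :
    ‖ofA Fq a‖ = (Fintype.card Fq : ℝ) ^ a.natDegree := by
  have hX : ‖ofA Fq (Polynomial.X ^ a.natDegree)‖ = (Fintype.card Fq : ℝ) ^ a.natDegree := by
    rw [map_pow, ofA_X, norm_pow, norm_theta]
  have h := a.eraseLead_add_C_mul_X_pow
  rw [ha.leadingCoeff, map_one, one_mul] at h
  have hlt : ‖ofA Fq a.eraseLead‖ < ‖ofA Fq (Polynomial.X ^ a.natDegree)‖ := by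
    rw [hX]
    rcases a.eraseLead_natDegree_lt_or_eraseLead_eq_zero with h1 | h1
    · exact (norm_ofA_le _).trans_lt (pow_lt_pow_right₀ (one_lt_card_real Fq) h1)
    · rw [h1, map_zero, norm_zero]
      exact pow_pos (one_pos.trans (one_lt_card_real Fq)) _
  conv_lhs => rw [← h, map_add]
  rw [IsUltrametricDist.norm_add_eq_max_of_norm_ne_norm hlt.ne, max_eq_right hlt.le, hX]

theorem algebraMap_powerSum (d s : ℕ) :
    algebraMap (RatFunc Fq) (CInf Fq) (powerSum Fq d s) =
      ∑ a : MonicOfDegree Fq d, (ofA Fq a.1 ^ s)⁻¹ := by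
  rw [powerSum_eq, map_sum]
  refine Finset.sum_congr rfl fun a _ => ?_
  rw [map_inv₀, map_pow]
  rfl

theorem algebraMap_zetaTerm (s : Fin r → ℕ) (ε : Fin r → Fqˣ) (a : ZetaIndex Fq r) :
    algebraMap (KInf Fq) (CInf Fq) (zetaTerm s ε a) =
      ∏ i, (algebraMap Fq (CInf Fq) (ε i : Fq) ^ (a.1 i).natDegree * (ofA Fq (a.1 i) ^ s i)⁻¹) := by
  have h : algebraMap (KInf Fq) (CInf Fq) (zetaTerm s ε a) =
    algebraMap (RatFunc Fq) (CInf Fq) (∏ i, RatFunc.C (ε i : Fq) ^ (a.1 i).natDegree /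
      algebraMap Fq[X] (RatFunc Fq) (a.1 i) ^ s i) := rfl
  rw [h, map_prod]
  refine Finset.prod_congr rfl fun i _ => ?_
  rw [map_div₀, map_pow, map_pow, div_eq_mul_inv]
  rfl

/-- The degrees of the entries of a tuple of monic polynomials. -/
def zetaDegree (a : ZetaIndex Fq r) : {d : Fin r → ℕ // StrictAnti d} :=
  ⟨fun i => (a.1 i).natDegree, a.2.2⟩

/-- The tuples of monic polynomials with given degrees. -/
def zetaFiberEquiv (d : {d : Fin r → ℕ // StrictAnti d}) :
    (zetaDegree (Fq := Fq) ⁻¹' {d}) ≃ ∀ i, MonicOfDegree Fq (d.1 i) where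
  toFun a i := ⟨a.1.1 i, a.1.2.1 i, congrFun (congrArg Subtype.val a.2) i⟩
  invFun b := ⟨⟨fun i => (b i).1, fun i => (b i).2.1, by
      have h : (fun i => (b i).1.natDegree) = d.1 := funext fun i => (b i).2.2
      rw [h]
      exact d.2⟩, Subtype.ext (funext fun i => (b i).2.2)⟩
  left_inv _ := rfl
  right_inv _ := rfl

/-- Since `s_i ≥ 1`, a term has absolute value at most `∏ q^(-d_i)` in the degrees `d_i`, and only
finitely many tuples share given degrees. -/
theorem summable_zetaTerm {s : Fin r → ℕ} (hs : ∀ i, 0 < s i) (ε : Fin r → Fqˣ) :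
    Summable (zetaTerm s ε) := by
  have h1 := one_lt_card_real Fq
  have h0 : (0 : ℝ) ≤ (Fintype.card Fq : ℝ)⁻¹ := by positivity
  refine NonarchimedeanAddGroup.summable_of_tendsto_cofinite_zero ?_
  refine squeeze_zero_norm
    (a := fun a => ∏ i, (Fintype.card Fq : ℝ)⁻¹ ^ (zetaDegree a).1 i) (fun a => ?_) ?_
  · rw [← norm_algebraMap' (CInf Fq), algebraMap_zetaTerm, norm_prod]
    refine Finset.prod_le_prod (fun _ _ => norm_nonneg _) fun i _ => ?_
    rw [norm_mul, norm_pow, norm_inv, norm_pow, norm_ofA_of_monic (a.2.1 i), inv_pow]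
    refine (mul_le_of_le_one_left (by positivity)
      (pow_le_one₀ (norm_nonneg _) (norm_le_one_algebraMap _))).trans ?_
    exact inv_anti₀ (by positivity) (le_self_pow₀ (one_le_pow₀ h1.le) (hs i).ne')
  · have hfin : Tendsto (fun a : ZetaIndex Fq r => (zetaDegree a).1) cofinite cofinite := by
      refine Tendsto.comp Subtype.val_injective.tendsto_cofinite
        (Filter.Tendsto.cofinite_of_finite_preimage_singleton fun d => ?_)
      have := Finite.of_equiv _ (zetaFiberEquiv (Fq := Fq) d).symm
      exact Set.toFinite _
    exact (tendsto_prod_cofinite (fun n => pow_nonneg h0 n)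
      (fun n => pow_le_one₀ h0 (inv_lt_one_of_one_lt₀ h1).le)
      (tendsto_pow_cofinite h0 (inv_lt_one_of_one_lt₀ h1))).comp hfin

/-- The sum over a fibre of the degree map runs over a product of finite sets, so it factors into
power sums. -/
theorem algebraMap_amzv {s : Fin r → ℕ} (hs : ∀ i, 0 < s i) (ε : Fin r → Fqˣ) :
    algebraMap (KInf Fq) (CInf Fq) (amzv s ε) =
      ∑' d : {d : Fin r → ℕ // StrictAnti d}, ∏ i, (algebraMap Fq (CInf Fq) (ε i : Fq) ^ d.1 i *
        algebraMap (RatFunc Fq) (CInf Fq) (powerSum Fq (d.1 i) (s i))) := by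
  have h := (summable_zetaTerm hs ε).hasSum.map (algebraMap (KInf Fq) (CInf Fq))
    (algebraMap_isometry (KInf Fq) (CInf Fq)).continuous
  rw [amzv, ← (h.tsum_fiberwise zetaDegree).tsum_eq]
  refine tsum_congr fun d => ?_
  rw [← (zetaFiberEquiv d).symm.tsum_eq, tsum_fintype]
  simp only [algebraMap_powerSum, Finset.mul_sum]
  rw [Finset.prod_univ_sum, Fintype.piFinset_univ]
  refine Finset.sum_congr rfl fun b _ => ?_
  rw [Function.comp_apply, algebraMap_zetaTerm]
  refine Finset.prod_congr rfl fun i _ => ?_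
  have hi : (((zetaFiberEquiv d).symm b).1.1 i).natDegree = d.1 i := (b i).2.2
  rw [hi]
  rfl

theorem evalAt_lSeries_eq_amzv {lam : CInf Fq} (hlam : lam ^ (Fintype.card Fq - 1) = -theta Fq)
    {s : Fin r → ℕ} (hs : ∀ i, 0 < s i) (ε : Fin r → Fqˣ) :
    evalAt (lSeries lam s ε) (theta Fq) =
      (∏ i, ofA Fq (carlitzGamma Fq (s i))) / piTilde lam ^ (∑ i, s i) *
        algebraMap (KInf Fq) (CInf Fq) (amzv s ε) := by
  rw [evalAt_lSeries hlam hs, algebraMap_amzv hs, ← tsum_mul_left]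
  refine tsum_congr fun d => ?_
  rw [← Finset.prod_pow_eq_pow_sum, ← Finset.prod_div_distrib, ← Finset.prod_mul_distrib]
  refine Finset.prod_congr rfl fun i _ => ?_
  ring

end Zeta

/-! ### The matrix equation `Ψ^(-1) = ΦΨ` and the period -/

section Trivialization

variable {Fq : Type*} [Field Fq] [Fintype Fq]

theorem twist_neg_one_twist_one (f : PowerSeries (CInf Fq)) : twist (-1) (twist (1 : ℕ) f) = f := by
  rw [twist_twist]
  exact twist_zero f

theorem twist_neg_one_C_algebraMap (c : Fq) :
    twist (-1) (PowerSeries.C (algebraMap Fq (CInf Fq) c)) =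
      PowerSeries.C (algebraMap Fq (CInf Fq) c) := by
  conv_lhs => rw [← algebraMap_pow_card_pow c 1, ← twist_C, twist_neg_one_twist_one]

variable {r : ℕ} {lam : CInf Fq} {γ : Fin r → KBar Fq} {ε : Fin r → Fqˣ}

/-- From `γ^(q-1) = ε` one gets `εγ = γ^q`, and the inverse twist fixes `ε`. This is the purpose of
the factors `γ` in `Ψ`. -/
theorem C_mul_twist_neg_one {g : CInf Fq} {e : Fqˣ}
    (h : g ^ (Fintype.card Fq - 1) = algebraMap Fq (CInf Fq) (e : Fq)) :
    PowerSeries.C (algebraMap Fq (CInf Fq) (e : Fq)) * twist (-1) (PowerSeries.C g) =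
      PowerSeries.C g := by
  rw [← twist_neg_one_C_algebraMap, ← map_mul, ← map_mul PowerSeries.C, ← h, ← pow_succ,
    Nat.sub_add_cancel Fintype.card_pos]
  conv_lhs => rw [← pow_one (Fintype.card Fq), ← twist_C, twist_neg_one_twist_one]

theorem C_prod_mul_twist_neg_one {ι : Type*} [Fintype ι] {g : ι → CInf Fq} {e : ι → Fqˣ}
    (h : ∀ i, g i ^ (Fintype.card Fq - 1) = algebraMap Fq (CInf Fq) (e i : Fq)) :
    PowerSeries.C (∏ i, algebraMap Fq (CInf Fq) (e i : Fq)) *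
      twist (-1) (PowerSeries.C (∏ i, g i)) = PowerSeries.C (∏ i, g i) := by
  simp only [map_prod]
  rw [← Finset.prod_mul_distrib]
  exact Finset.prod_congr rfl fun i _ => C_mul_twist_neg_one (h i)

theorem tailWeight_castSucc (s : Fin r → ℕ) (i : Fin r) :
    tailWeight s i.castSucc = s i + tailWeight s i.succ := by
  have h : (Finset.univ.filter fun m : Fin r => i.castSucc ≤ m.castSucc) =
      insert i (Finset.univ.filter fun m : Fin r => i.succ ≤ m.castSucc) := by
    ext m
    simp only [Finset.mem_filter, Finset.mem_univ, true_and, Finset.mem_insert, Fin.le_def,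
      Fin.val_castSucc, Fin.val_succ, Fin.ext_iff]
    omega
  rw [tailWeight, h, Finset.sum_insert (by simp [Fin.le_def]), tailWeight]

theorem tailWeight_last (s : Fin r → ℕ) : tailWeight s (Fin.last r) = 0 := by
  rw [tailWeight, Finset.sum_eq_zero]
  intro m hm
  rw [Finset.mem_filter, Fin.le_def] at hm
  have := m.2
  simp only [Fin.val_last, Fin.val_castSucc] at hm
  omega

theorem isEmpty_slice {i j : Fin (r + 1)} (h : i ≤ j) : IsEmpty (Slice i j) :=
  ⟨fun m => absurd (h.trans m.2.1) m.2.2.not_ge⟩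

theorem psi_of_lt {i j : Fin (r + 1)} (s : Fin r → ℕ) (h : i < j) : psi lam s ε γ i j = 0 := by
  rw [psi, Matrix.of_apply, if_neg h.not_ge]

theorem psi_self (s : Fin r → ℕ) (i : Fin (r + 1)) :
    psi lam s ε γ i i = omega lam ^ tailWeight s i := by
  have := isEmpty_slice (le_refl i)
  rw [psi, Matrix.of_apply, if_pos le_rfl, lSeries_of_isEmpty, Finset.univ_eq_empty]
  simp

/-- The matrix `Φ` over `k̄[t]`. -/
def phiPoly (lam : CInf Fq) (s : Fin r → ℕ) (γ : Fin r → KBar Fq) :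
    Matrix (Fin (r + 1)) (Fin (r + 1)) (KBar Fq)[X] :=
  Matrix.of fun i j =>
    if i = j then (Polynomial.X - Polynomial.C (thetaBar Fq)) ^ tailWeight s i
    else if h : (i : ℕ) = j + 1 then
      Polynomial.C ((frobBar Fq).symm (γ ⟨j, by omega⟩)) *
        (Polynomial.X - Polynomial.C (thetaBar Fq)) ^ tailWeight s j *
        ((andersonThakur lam (s ⟨j, by omega⟩)).map (ofABar Fq)).map
          ((frobBar Fq).symm : KBar Fq →+* KBar Fq)
    else 0

theorem ratTwist_neg_one_algebraMap (p : (KBar Fq)[X]) :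
    ratTwist (-1) (algebraMap (KBar Fq)[X] (RatFunc (KBar Fq)) p) =
      algebraMap (KBar Fq)[X] (RatFunc (KBar Fq))
        (p.map ((frobBar Fq).symm : KBar Fq →+* KBar Fq)) := by
  have h : ∀ y, ratTwist (-1) y = (ratFrob Fq).symm y := by
    intro y
    rw [ratTwist, zpow_neg_one]
    rfl
  rw [h, RingEquiv.symm_apply_eq, ratFrob, IsFractionRing.ringEquivOfRingEquiv_algebraMap]
  congr 1
  ext n
  simp

/-- The entries of `Φ` are polynomials in `t`, so `Ψ^(-1) = ΦΨ` can be verified among power series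
in `𝕋` before passing to `𝕃`. -/
theorem phi_eq_map (lam : CInf Fq) (s : Fin r → ℕ) (γ : Fin r → KBar Fq) :
    phi lam s γ = (phiPoly lam s γ).map (algebraMap (KBar Fq)[X] (RatFunc (KBar Fq))) := by
  have ht : tSubTheta Fq = algebraMap (KBar Fq)[X] (RatFunc (KBar Fq))
      (Polynomial.X - Polynomial.C (thetaBar Fq)) := by
    simp [tSubTheta]
  ext1 i j
  rw [phi, phiPoly, Matrix.map_apply, Matrix.of_apply, Matrix.of_apply]
  split_ifs
  · rw [ht, map_pow]
  · rw [ht, map_mul, map_mul, map_pow, toRat, ← RatFunc.algebraMap_C, ratTwist_neg_one_algebraMap,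
      ratTwist_neg_one_algebraMap, Polynomial.map_C]
    rfl
  · rw [map_zero]

theorem coe_polyToTate (p : (KBar Fq)[X]) : (polyToTate Fq p : PowerSeries (CInf Fq)) =
    PowerSeries.map (algebraMap (KBar Fq) (CInf Fq)) p := rfl

theorem coe_frobBar_symm (x : KBar Fq) :
    algebraMap (KBar Fq) (CInf Fq) ((frobBar Fq).symm x) =
      (frob Fq ^ (-1 : ℤ) : RingAut (CInf Fq)) (algebraMap (KBar Fq) (CInf Fq) x) := by
  rw [zpow_neg_one]
  refine ((frob Fq).symm_apply_eq.mpr ?_).symm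
  have h : algebraMap (KBar Fq) (CInf Fq) (frobBar Fq ((frobBar Fq).symm x)) =
    frob Fq (algebraMap (KBar Fq) (CInf Fq) ((frobBar Fq).symm x)) := rfl
  rw [← h, RingEquiv.apply_symm_apply]

theorem coe_polyToTate_map_frobBar_symm (p : (KBar Fq)[X]) :
    (polyToTate Fq (p.map ((frobBar Fq).symm : KBar Fq →+* KBar Fq)) : PowerSeries (CInf Fq)) =
      twist (-1) (polyToTate Fq p : PowerSeries (CInf Fq)) := by
  ext n
  rw [coe_polyToTate, coe_polyToTate, twist, PowerSeries.coeff_map, PowerSeries.coeff_map,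
    PowerSeries.coeff_map, Polynomial.coeff_coe, Polynomial.coeff_coe, Polynomial.coeff_map]
  exact coe_frobBar_symm _

theorem coe_polyToTate_map_ofABar (H : Fq[X][X]) :
    (polyToTate Fq (H.map (ofABar Fq)) : PowerSeries (CInf Fq)) = toSeries H := by
  ext n
  rw [coe_polyToTate, PowerSeries.coeff_map, Polynomial.coeff_coe, Polynomial.coeff_map, toSeries,
    Polynomial.coeff_coe, Polynomial.coeff_map]
  rfl

theorem coe_polyToTate_C (x : KBar Fq) :
    (polyToTate Fq (Polynomial.C x) : PowerSeries (CInf Fq)) = PowerSeries.C (x : CInf Fq) := by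
  rw [coe_polyToTate, Polynomial.coe_C, PowerSeries.map_C]
  rfl

theorem coe_polyToTate_X_sub_C :
    (polyToTate Fq (Polynomial.X - Polynomial.C (thetaBar Fq)) : PowerSeries (CInf Fq)) =
      PowerSeries.X - PowerSeries.C (theta Fq) := by
  rw [coe_polyToTate, Polynomial.coe_sub, Polynomial.coe_X, Polynomial.coe_C, map_sub,
    PowerSeries.map_X, PowerSeries.map_C]
  rfl

theorem coe_phiPoly_self (s : Fin r → ℕ) (i : Fin (r + 1)) :
    (polyToTate Fq (phiPoly lam s γ i i) : PowerSeries (CInf Fq)) =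
      (PowerSeries.X - PowerSeries.C (theta Fq)) ^ tailWeight s i := by
  rw [phiPoly, Matrix.of_apply, if_pos rfl, map_pow, SubmonoidClass.coe_pow, coe_polyToTate_X_sub_C]

theorem coe_phiPoly_succ (s : Fin r → ℕ) (i : Fin r) :
    (polyToTate Fq (phiPoly lam s γ i.succ i.castSucc) : PowerSeries (CInf Fq)) =
      twist (-1) (PowerSeries.C (γ i : CInf Fq)) *
        (PowerSeries.X - PowerSeries.C (theta Fq)) ^ tailWeight s i.castSucc *
        twist (-1) (toSeries (andersonThakur lam (s i))) := by
  have h : phiPoly lam s γ i.succ i.castSucc = (Polynomial.C (γ i)).map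
      ((frobBar Fq).symm : KBar Fq →+* KBar Fq) *
        (Polynomial.X - Polynomial.C (thetaBar Fq)) ^ tailWeight s i.castSucc *
        ((andersonThakur lam (s i)).map (ofABar Fq)).map
          ((frobBar Fq).symm : KBar Fq →+* KBar Fq) := by
    rw [phiPoly, Matrix.of_apply, if_neg i.castSucc_lt_succ.ne', dif_pos (by simp),
      Polynomial.map_C]
    rfl
  rw [h, map_mul, map_mul, map_pow, MulMemClass.coe_mul, MulMemClass.coe_mul,
    SubmonoidClass.coe_pow, coe_polyToTate_X_sub_C, coe_polyToTate_map_frobBar_symm,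
    coe_polyToTate_map_frobBar_symm, coe_polyToTate_C, coe_polyToTate_map_ofABar]

theorem phiPoly_eq_zero (s : Fin r → ℕ) {i j : Fin (r + 1)} (h1 : i ≠ j) (h2 : (i : ℕ) ≠ j + 1) :
    phiPoly lam s γ i j = 0 := by
  rw [phiPoly, Matrix.of_apply, if_neg h1, dif_neg h2]

section

variable (hlam : lam ^ (Fintype.card Fq - 1) = -theta Fq) {s : Fin r → ℕ} (hs : ∀ i, 0 < s i)

include hlam hs

/-- The recursion for the entries of `Ψ` below the diagonal. -/
theorem twist_neg_one_psi_succ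
    (hγ : ∀ i, (γ i : CInf Fq) ^ (Fintype.card Fq - 1) = algebraMap Fq (CInf Fq) (ε i : Fq))
    (i : Fin r) {j : Fin (r + 1)} (hj : j ≤ i.castSucc) :
    twist (-1) (psi lam s ε γ i.succ j) =
      (PowerSeries.X - PowerSeries.C (theta Fq)) ^ tailWeight s i.succ * psi lam s ε γ i.succ j +
      twist (-1) (PowerSeries.C (γ i : CInf Fq)) *
        (PowerSeries.X - PowerSeries.C (theta Fq)) ^ tailWeight s i.castSucc *
        twist (-1) (toSeries (andersonThakur lam (s i))) * psi lam s ε γ i.castSucc j := by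
  -- Passing to the next row adds exactly one index, `i`, and it is the greatest: the situation of
  -- `lSeries_eq`.
  let f : Slice i.castSucc j → Slice i.succ j := fun y =>
    ⟨y.1, y.2.1, y.2.2.trans i.castSucc_lt_succ⟩
  let m : Slice i.succ j := ⟨i, hj, i.castSucc_lt_succ⟩
  have hf : StrictMono f := fun _ _ h => h
  have hm : ∀ x, x = m ∨ x ∈ Set.range f := by
    intro x
    by_cases hx : x.1 = i
    · exact Or.inl (Subtype.ext hx)
    · refine Or.inr ⟨⟨x.1, x.2.1, ?_⟩, rfl⟩
      have h1 := x.2.2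
      rw [Fin.lt_def] at h1 ⊢
      rw [Fin.ext_iff] at hx
      simp only [Fin.val_castSucc, Fin.val_succ] at h1 ⊢
      omega
  have hmf : ∀ y, f y < m := fun y => y.2.2
  have hmr : m ∉ Set.range f := fun ⟨y, hy⟩ => (hmf y).ne hy
  -- The inverse twist of the functional equation: both first twists on its right side disappear,
  -- and `Ω^(s_i)` acquires the factor `(t-θ)^(s_i)`.
  have hL := congrArg (twist (-1)) (lSeries_eq hlam (s := fun m : Slice i.succ j => s m)
    (fun m => hs m) (fun m : Slice i.succ j => ε m) hf hm hmf)
  have hE : ∀ {κ : Type} [Fintype κ] (e : κ → Fqˣ),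
      twist (-1) (PowerSeries.C (∏ x, algebraMap Fq (CInf Fq) (e x : Fq))) =
        PowerSeries.C (∏ x, algebraMap Fq (CInf Fq) (e x : Fq)) := by
    intro κ _ e
    rw [← map_prod (algebraMap Fq (CInf Fq)), twist_neg_one_C_algebraMap]
  rw [map_add, map_mul, map_mul, map_mul, twist_neg_one_twist_one, twist_neg_one_twist_one,
    map_mul, map_pow, twist_neg_one_omega hlam, hE (fun x : Slice i.succ j => ε x),
    hE (fun y : Slice i.castSucc j => ε (f y))] at hL
  have hL' : twist (-1) (lSeries lam (fun m : Slice i.succ j => s m) fun m => ε m) =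
      PowerSeries.C (∏ m : Slice i.succ j, algebraMap Fq (CInf Fq) (ε m : Fq)) *
        lSeries lam (fun m : Slice i.succ j => s m) (fun m => ε m) +
      PowerSeries.C (∏ m : Slice i.castSucc j, algebraMap Fq (CInf Fq) (ε m : Fq)) *
        lSeries lam (fun m : Slice i.castSucc j => s m) (fun m => ε m) *
        (twist (-1) (toSeries (andersonThakur lam (s i))) *
          ((PowerSeries.X - PowerSeries.C (theta Fq)) * omega lam) ^ s i) := hL
  have hγ1 := C_prod_mul_twist_neg_one (g := fun m : Slice i.succ j => (γ m : CInf Fq))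
    (e := fun m : Slice i.succ j => ε m) fun m => hγ m
  have hγ2 := C_prod_mul_twist_neg_one (g := fun m : Slice i.castSucc j => (γ m : CInf Fq))
    (e := fun m : Slice i.castSucc j => ε m) fun m => hγ m
  have hγ3 : twist (-1) (PowerSeries.C (∏ m : Slice i.succ j, (γ m : CInf Fq))) =
      twist (-1) (PowerSeries.C (γ i : CInf Fq)) *
        twist (-1) (PowerSeries.C (∏ m : Slice i.castSucc j, (γ m : CInf Fq))) := by
    rw [prod_eq_mul_prod_comp hf.injective hm hmr, map_mul, map_mul]
  rw [psi, Matrix.of_apply, Matrix.of_apply, if_pos (hj.trans i.castSucc_lt_succ.le), if_pos hj,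
    map_mul, map_mul, map_pow, twist_neg_one_omega hlam, hL', tailWeight_castSucc]
  -- Regrouped so that each product of `ε` meets the inverse twist of the matching product of `γ`;
  -- in the second summand `γ_i^(-1)` is left over and becomes part of the entry of `Φ` below the
  -- diagonal.
  calc _ = (PowerSeries.C (∏ m : Slice i.succ j, algebraMap Fq (CInf Fq) (ε m : Fq)) *
        twist (-1) (PowerSeries.C (∏ m : Slice i.succ j, (γ m : CInf Fq)))) *
        lSeries lam (fun m : Slice i.succ j => s m) (fun m => ε m) *
        ((PowerSeries.X - PowerSeries.C (theta Fq)) * omega lam) ^ tailWeight s i.succ +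
      twist (-1) (PowerSeries.C (∏ m : Slice i.succ j, (γ m : CInf Fq))) *
        (PowerSeries.C (∏ m : Slice i.castSucc j, algebraMap Fq (CInf Fq) (ε m : Fq)) *
        lSeries lam (fun m : Slice i.castSucc j => s m) (fun m => ε m) *
        (twist (-1) (toSeries (andersonThakur lam (s i))) *
          ((PowerSeries.X - PowerSeries.C (theta Fq)) * omega lam) ^ s i)) *
        ((PowerSeries.X - PowerSeries.C (theta Fq)) * omega lam) ^ tailWeight s i.succ := by ring
    _ = _ := by
      rw [hγ1, hγ3]
      conv_rhs => rw [← hγ2]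
      simp only [pow_add, mul_pow]
      ring

theorem coeffBound_psi (ε : Fin r → Fqˣ) (γ : Fin r → KBar Fq) (i j : Fin (r + 1)) :
    ∃ B, CoeffBound (rho Fq) B (psi lam s ε γ i j) := by
  rw [psi, Matrix.of_apply]
  split_ifs
  · exact ⟨_, ((coeffBound_C (rho Fq) _).mul (rho_pos Fq) (coeffBound_lSeries hlam
      (s := fun m : Slice i j => s m) (fun m => hs m) fun m => ε m)).mul (rho_pos Fq)
      ((coeffBound_omega lam).pow (rho_pos Fq) _)⟩
  · exact ⟨0, fun n => by simp⟩

theorem psi_mem_tate (ε : Fin r → Fqˣ) (γ : Fin r → KBar Fq) (i j : Fin (r + 1)) :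
    psi lam s ε γ i j ∈ PowerSeries.IsRestricted.subring (R := CInf Fq) 1 := by
  obtain ⟨B, hB⟩ := coeffBound_psi hlam hs ε γ i j
  exact hB.mem_tate (one_lt_rho Fq)

theorem convergesAt_psi (ε : Fin r → Fqˣ) (γ : Fin r → KBar Fq) (i j : Fin (r + 1)) :
    ConvergesAt (psi lam s ε γ i j) (theta Fq) := by
  obtain ⟨B, hB⟩ := coeffBound_psi hlam hs ε γ i j
  exact hB.convergesAt (norm_theta_lt_rho Fq)

/-- A row of `Φ` has at most two nonzero entries, so a diagonal entry of `Ψ` needs only the equation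
of `Ω`, and an entry below it only the recursion from the preceding row. -/
theorem twist_neg_one_psi
    (hγ : ∀ i, (γ i : CInf Fq) ^ (Fintype.card Fq - 1) = algebraMap Fq (CInf Fq) (ε i : Fq))
    (i j : Fin (r + 1)) : twist (-1) (psi lam s ε γ i j) =
      ∑ l, (polyToTate Fq (phiPoly lam s γ i l) : PowerSeries (CInf Fq)) * psi lam s ε γ l j := by
  have hdiag : ∀ i, twist (-1) (psi lam s ε γ i i) =
      (PowerSeries.X - PowerSeries.C (theta Fq)) ^ tailWeight s i * psi lam s ε γ i i := by
    intro i
    rw [psi_self, map_pow, twist_neg_one_omega hlam, mul_pow]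
  cases i using Fin.cases with
  | zero =>
    rw [Fintype.sum_eq_single 0, coe_phiPoly_self]
    · rcases (Fin.zero_le j).eq_or_lt with rfl | hj
      · exact hdiag 0
      · rw [psi_of_lt s hj, map_zero, mul_zero]
    · intro l hl
      rw [phiPoly_eq_zero s hl.symm (by simp), map_zero, ZeroMemClass.coe_zero, zero_mul]
  | succ i =>
    rw [Fintype.sum_eq_add i.succ i.castSucc i.castSucc_lt_succ.ne', coe_phiPoly_self,
      coe_phiPoly_succ]
    · rcases lt_trichotomy i.succ j with hj | rfl | hj
      · rw [psi_of_lt s hj, psi_of_lt s (i.castSucc_lt_succ.trans hj), map_zero, mul_zero, mul_zero,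
          add_zero]
      · rw [psi_of_lt s i.castSucc_lt_succ, mul_zero, add_zero, hdiag]
      · exact twist_neg_one_psi_succ hlam hs hγ i (Fin.le_castSucc_iff.mpr hj)
    · rintro l ⟨h1, h2⟩
      rw [phiPoly_eq_zero s h1.symm, map_zero, ZeroMemClass.coe_zero, zero_mul]
      intro h
      apply h2
      ext
      simp only [Fin.val_succ] at h
      simp only [Fin.val_castSucc]
      omega

/-- The matrix `Ψ` over `𝕋`. -/
def psiTate (ε : Fin r → Fqˣ) (γ : Fin r → KBar Fq) :
    Matrix (Fin (r + 1)) (Fin (r + 1)) (Tate Fq) :=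
  Matrix.of fun i j => ⟨psi lam s ε γ i j, psi_mem_tate hlam hs ε γ i j⟩

theorem isRigidAnalyticTrivialization_psiTate
    (hγ : ∀ i, (γ i : CInf Fq) ^ (Fintype.card Fq - 1) = algebraMap Fq (CInf Fq) (ε i : Fq)) :
    IsRigidAnalyticTrivialization (phi lam s γ)
      ((psiTate hlam hs ε γ).map (algebraMap (Tate Fq) (LField Fq))) := by
  constructor
  -- The determinant is a product of powers of `Ω`, which is nonzero in the field `𝕃`; it need not
  -- be a unit of `𝕋`.
  · rw [Matrix.isUnit_iff_isUnit_det, Matrix.det_of_isLowerTriangular]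
    · refine (Finset.prod_ne_zero_iff.mpr fun i _ => ?_).isUnit
      rw [Matrix.map_apply, Ne, IsFractionRing.to_map_eq_zero_iff]
      intro h
      have h' : psi lam s ε γ i i = 0 := congrArg Subtype.val h
      rw [psi_self] at h'
      exact pow_ne_zero _ (omega_ne_zero hlam) h'
    · intro i j hij
      have h : psiTate hlam hs ε γ i j = 0 := Subtype.ext (psi_of_lt s hij)
      rw [Matrix.map_apply, h, map_zero]
  · ext1 i j
    have h1 : ∀ x, lTwistInv Fq (algebraMap (Tate Fq) (LField Fq) x) =
        algebraMap (Tate Fq) (LField Fq) (tateTwistInv Fq x) := fun x =>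
      IsLocalization.map_eq (M := nonZeroDivisors (Tate Fq)) (T := nonZeroDivisors (Tate Fq))
        (nonZeroDivisors_le_comap_nonZeroDivisors_of_injective _ (tateTwistInv_injective Fq)) x
    have h2 : ∀ p, ratToL Fq (algebraMap (KBar Fq)[X] (RatFunc (KBar Fq)) p) =
        algebraMap (Tate Fq) (LField Fq) (polyToTate Fq p) := fun p =>
      IsFractionRing.lift_algebraMap _ p
    rw [Matrix.map_apply, Matrix.map_apply, Matrix.mul_apply, h1, phi_eq_map]
    simp only [Matrix.map_apply, h2, ← map_mul, ← map_sum]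
    congr 1
    refine Subtype.ext ?_
    rw [AddSubmonoidClass.coe_finsetSum]
    exact twist_neg_one_psi hlam hs hγ i j

/-- The order isomorphism between the indices `1, …, r` and the indices of the lower left entry. -/
def sliceLastZero (r : ℕ) : Slice (Fin.last r) 0 ≃o Fin r where
  toFun m := m.1
  invFun m := ⟨m, Fin.zero_le _, m.castSucc_lt_last⟩
  left_inv _ := rfl
  right_inv _ := rfl
  map_rel_iff' := Iff.rfl

/-- In the last row the power of `Ω` is trivial, and the index set of the corner entry is all of `1,
…, r`, so only `γ_1 ⋯ γ_r L(s; ε)` has to be evaluated. -/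
theorem evalAt_psi_last_zero (ε : Fin r → Fqˣ) (γ : Fin r → KBar Fq) :
    evalAt (psi lam s ε γ (Fin.last r) 0) (theta Fq) =
      (∏ i, (γ i : CInf Fq)) * (∏ i, ofA Fq (carlitzGamma Fq (s i))) / piTilde lam ^ (∑ i, s i) *
        algebraMap (KInf Fq) (CInf Fq) (amzv s ε) := by
  have hL : lSeries lam (fun m : Slice (Fin.last r) 0 => s m) (fun m => ε m) = lSeries lam s ε :=
    lSeries_comp_orderIso lam s ε (sliceLastZero r)
  have hγ : ∏ m : Slice (Fin.last r) 0, (γ m : CInf Fq) = ∏ i, (γ i : CInf Fq) :=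
    Fintype.prod_equiv (sliceLastZero r).toEquiv _ _ fun _ => rfl
  rw [psi, Matrix.of_apply, if_pos (Fin.zero_le _), tailWeight_last, pow_zero, mul_one, hL, hγ,
    evalAt_mul (convergesAt_C _ _)
      ((coeffBound_lSeries hlam hs ε).convergesAt (norm_theta_lt_rho Fq)), evalAt_C,
    evalAt_lSeries_eq_amzv hlam hs]
  ring

end

end Trivialization

end AMZV

theorem mainTheorem4 {Fq : Type*} [Field Fq] [Fintype Fq] {r : ℕ}
    (s : Fin r → ℕ) (hs : ∀ i, 0 < s i) (ε : Fin r → Fqˣ)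
    (lam : CInf Fq) (hlam : lam ^ (Fintype.card Fq - 1) = -theta Fq)
    (γ : Fin r → KBar Fq)
    (hγ : ∀ i, (γ i : CInf Fq) ^ (Fintype.card Fq - 1) = algebraMap Fq (CInf Fq) (ε i : Fq)) :
    -- `Ω` is well defined and converges at `t = θ`, with `Ω(θ) = 1 / π̃ ≠ 0`
    (∀ n, Filter.Tendsto (fun N => PowerSeries.coeff n (omegaPartial lam N)) Filter.atTop
      (nhds (PowerSeries.coeff n (omega lam)))) ∧
    ConvergesAt (omega lam) (theta Fq) ∧ evalAt (omega lam) (theta Fq) ≠ 0 ∧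
    -- the Anderson–Thakur polynomials exist and are unique
    (∀ n, 0 < n → ∃! H : Polynomial (Polynomial Fq), IsAndersonThakur lam n H) ∧
    -- the series `ζ_A(s; ε)` and `L(s_j, …, s_{i-1})` converge
    Summable (zetaTerm s ε) ∧
    (∀ (i j : Fin (r + 1)) (n : ℕ), Summable
      fun d : {d : Slice i j → ℕ // StrictAnti d} => PowerSeries.coeff n
        (lTerm lam (fun m : Slice i j => s m) (fun m : Slice i j => ε m) d.1)) ∧
    -- `M` is a pre-`t`-motive of dimension `r + 1` on which `σ` is represented by `Φ`
    IsPreTMotive Fq (Motive lam s γ) ∧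
    Module.finrank (RatFunc (KBar Fq)) (Motive lam s γ) = r + 1 ∧
    sigmaMatrix (τ := ratTwist (-1))
      (ModuleOf.basis (isUnit_phi lam s γ).unit :
        Module.Basis (Fin (r + 1)) (RatFunc (KBar Fq)) (Motive lam s γ)) = phi lam s γ ∧
    -- `Ψ` is a rigid analytic trivialization of `Φ` whose entries converge at `t = θ`
    (∃ Ψ : Matrix (Fin (r + 1)) (Fin (r + 1)) (Tate Fq),
      (∀ i j, (Ψ i j : PowerSeries (CInf Fq)) = psi lam s ε γ i j) ∧
      IsRigidAnalyticTrivialization (phi lam s γ) (Ψ.map (algebraMap (Tate Fq) (LField Fq)))) ∧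
    (∀ i j, ConvergesAt (psi lam s ε γ i j) (theta Fq)) ∧
    -- `ζ_A(s; ε)` is, up to the explicit factors, the lower left entry of `Ψ|_{t=θ}`
    evalAt (psi lam s ε γ (Fin.last r) 0) (theta Fq) =
      (∏ i, (γ i : CInf Fq)) * (∏ i, ofA Fq (carlitzGamma Fq (s i))) / piTilde lam ^ (∑ i, s i) *
        algebraMap (KInf Fq) (CInf Fq) (amzv s ε) ∧
    -- hence it is, up to these factors, a period of `M`
    IsPeriod (Motive lam s γ)
      ((∏ i, (γ i : CInf Fq)) * (∏ i, ofA Fq (carlitzGamma Fq (s i))) /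
        piTilde lam ^ (∑ i, s i) * algebraMap (KInf Fq) (CInf Fq) (amzv s ε)) := by
  refine ⟨tendsto_coeff_omegaPartial lam, convergesAt_omega lam, evalAt_omega_ne_zero hlam,
    fun n hn => existsUnique_andersonThakur hlam hn, summable_zetaTerm hs ε,
    fun i j n => summable_coeff_lTerm hlam (s := fun m : Slice i j => s m) (fun m => hs m) _ n,
    inferInstance, ?_,
    ModuleOf.sigmaMatrix_basis _, ⟨psiTate hlam hs ε γ, fun _ _ => rfl,
      isRigidAnalyticTrivialization_psiTate hlam hs hγ⟩, convergesAt_psi hlam hs ε γ,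
    evalAt_psi_last_zero hlam hs ε γ, ?_⟩
  · rw [Module.finrank_eq_card_basis (ModuleOf.basis (τ := ratTwist (-1))
      (isUnit_phi lam s γ).unit), Fintype.card_fin]
  -- The period is witnessed by the defining basis of `M`, where `σ` is represented by `Φ`, and by
  -- the corner of `Ψ`.
  · refine ⟨r + 1, ModuleOf.basis (isUnit_phi lam s γ).unit, psiTate hlam hs ε γ, ?_,
      convergesAt_psi hlam hs ε γ, Fin.last r, 0, (evalAt_psi_last_zero hlam hs ε γ).symm⟩
    rw [ModuleOf.sigmaMatrix_basis]
    exact isRigidAnalyticTrivialization_psiTate hlam hs hγ
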